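/- Let $p\ge 0$ be an integer, $\mathcal O\subset\mathbb R^p$ open, and $f,h:\mathcal O\to\mathbb R$ smooth functions of $(x_1,\dots,x_p)$. Let $M=\mathbb R\times\mathcal O\times\mathbb R^{p+1}$ with coordinates $(x_0,\dots,x_p,y_0,\dots,y_p)$, and write $f_i=\partial f/\partial x_i$, $h_i=\partial h/\partial x_i$. With $dx\odot dy:=dx\otimes dy+dy\otimes dx$, put $$g_{(f,h)}=\sum_{i=1}^p\bigl(f_i\,dx_0\odot dx_i+h_i\,dx_i\odot dy_0\bigr)+\sum_{i,j=1}^p (f_if_j+h_ih_j)\,dx_i\otimes dx_j+\sum_{i=1}^p dx_i\odot dy_i .$$ Let $\overline M$ be the $(2p+4)$-dimensional real vector space with basis $u_0,\dots,u_p,v_0,\dots,v_p,w_1,w_2$ and the symmetric bilinear form $\overline g$ whose only nonzero products of basis vectors are $\overline g(u_i,v_i)=1$ $(1\le i\le p)$, $\overline g(u_0,w_1)=\overline g(v_0,w_2)=1$, $\overline g(w_1,w_1)=\overline g(w_2,w_2)=1$ (and those given by symmetry). Let $F:M\to\overline M$, $F(x,y)=\sum_{i=0}^p x_iu_i+\sum_{i=0}^p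 y_iv_i+f\,w_1+h\,w_2$. Terminology. Let $M$ be a submanifold of $\overline M$ with induced metric $g$. It is $r$-lightlike if $\mathrm{Rad}\,TM=TM\cap TM^\perp$ is a smooth distribution of rank $r>0$, and coisotropic if moreover $r$ is the codimension of $M$. Screens consist of smooth complements $S(TM)$ of $\mathrm{Rad}\,TM$ in $TM$ and $S(TM^\perp)$ of $\mathrm{Rad}\,TM$ in $TM^\perp$ (so $S(TM^\perp)=0$ in the coisotropic case), together with a bundle $ltr(TM)\subset S(TM)^\perp\cap S(TM^\perp)^\perp$ locally spanned by smooth sections $N_1,\dots,N_r$ with $\overline g(N_i,\xi_j)=\delta_{ij}$, $\overline g(N_i,N_j)=0$ for a local frame $\xi_1,\dots,\xi_r$ of $\mathrm{Rad}\,TM$. Let $\nabla$ be the induced connection, i.e. the $TM$-part of the flat connection of $\overline M$ with respect to $T\overline M|_M=TM\oplus(ltr(TM)\oplus S(TM^\perp))$, and $R(X,Y,Z,W)=g(R(X,Y)Z,W)$ its curvature. The screens are admissible if $R$ is an algebraic curvature tensor at each point, i.e. $R(x,y,z,w)=-R(y,x,z,w)=R(z,w,x,y)$ and $R(x,y,z,w)+R(y,z,x,w)+R(z,x,y,w)=0$.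 Put $\eta_i=\overline g(N_i,\cdot)$ and $\tilde g=g+\sum_{i=1}^r\eta_i\otimes\eta_i$. For $x\in T_qM$ with $g(x,x)=\pm1$, the pseudo-Jacobi operator $J_R(x)$ on $T_qM$ is defined by $\tilde g(J_R(x)y,w)=R(y,x,x,w)$. $M$ is globally Osserman if, for all admissible screens, the characteristic polynomial of $J_R(x)$ does not depend on $q\in M$ and on $x\in T_qM$ with $g(x,x)=1$, and the same holds for the $x$ with $g(x,x)=-1$. Then: 1. $\overline g$ is nondegenerate of signature $(p+2,p+2)$; $F$ is a smooth embedding and $F^*\overline g=g_{(f,h)}$; the kernel of $g_{(f,h)}$ has dimension $2$ at every point; and $F(M)$ is a coisotropic ($2$-lightlike) submanifold of $\overline M$, with $\mathrm{Rad}\,TM$ spanned by $\xi_1=\partial_{x_0}-\sum_{i=1}^p f_i\,\partial_{y_i}$ and $\xi_2=\partial_{y_0}-\sum_{i=1}^p h_i\,\partial_{y_i}$. 2. $S(TM)=\mathrm{Span}\{\partial_{x_i}-f_i\partial_{x_0}-h_i\partial_{y_0},\ \partial_{y_i}: 1\le i\le p\}$, $S(TM^\perp)=0$ and $ltr(TM)=\mathrm{Span}\{w_1-\tfrac12\xi_1,\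 w_2-\tfrac12\xi_2\}$ are admissible screens. 3. For all admissible screens, all $q\in M$ and all $x\in T_qM$ with $g(x,x)=\pm1$, for any choice of dual bases $\xi_1,\xi_2$ and $N_1,N_2$ of $\mathrm{Rad}\,T_qM$ and of the fibre of $ltr(TM)$ at $q$, the operator $J_R(x)$ exists and is unique, is nilpotent, and has characteristic polynomial $\lambda^{2p+2}$. 4. Consequently $M$ is globally Osserman. -/

import Mathlib

open scoped ContDiff

noncomputable section

namespace LightlikeOsserman

section General

/-! ## Submanifolds of a semi-Euclidean space given by one global chart

`(V, B)` is the ambient vector space with its constant metric; the submanifold is the image of an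
open set `U` of `E` under `F : E → V`.  The tangent space at the point with coordinates `u` is
identified with `E` by the differential of `F` at `u`. -/

variable {E V : Type*} [NormedAddCommGroup E] [NormedSpace ℝ E]
  [NormedAddCommGroup V] [NormedSpace ℝ V]

/-- `B` is a semi-Euclidean metric of signature `(a, b)`. -/
structure IsSemiEuclidean (B : LinearMap.BilinForm ℝ V) (a b : ℕ) : Prop where
  symm : B.IsSymm
  nondegenerate : B.Nondegenerate
  sig_pos : sigPos B.toQuadraticMap = a
  sig_neg : sigNeg B.toQuadraticMap = b

/-- `F` is a smooth embedding of the open set `U`. -/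
structure IsSmoothEmbedding (U : Set E) (F : E → V) : Prop where
  isOpen : IsOpen U
  smooth : ContDiffOn ℝ ∞ F U
  immersion : ∀ u ∈ U, Function.Injective (fderiv ℝ F u)
  embedding : Topology.IsEmbedding (U.domRestrict F)

/-- The induced metric `F^* B`. -/
def inducedMetric (B : LinearMap.BilinForm ℝ V) (F : E → V) (u : E) : LinearMap.BilinForm ℝ E :=
  B.comp (fderiv ℝ F u).toLinearMap (fderiv ℝ F u).toLinearMap

/-- The tangent space as a subspace of the ambient space. -/
def tangentSpace (F : E → V) (u : E) : Submodule ℝ V :=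
  LinearMap.range (fderiv ℝ F u).toLinearMap

/-- The vectors which are `B`-orthogonal to `S`. -/
def perp (B : LinearMap.BilinForm ℝ V) (S : Submodule ℝ V) : Submodule ℝ V :=
  B.orthogonal S

/-- The radical of the tangent space, `T_u M ∩ T_u M^⊥`. -/
def radSpace (B : LinearMap.BilinForm ℝ V) (F : E → V) (u : E) : Submodule ℝ V :=
  tangentSpace F u ⊓ perp B (tangentSpace F u)

/-- `u ↦ S u` is a smooth vector subbundle over `U` of the trivial bundle with fibre `V`: it has
smooth local frames. -/
def IsSmoothSubbundle (U : Set E) (S : E → Submodule ℝ V) : Prop :=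
  ∀ u₀ ∈ U, ∃ W : Set E, IsOpen W ∧ u₀ ∈ W ∧ W ⊆ U ∧
    ∃ (k : ℕ) (s : Fin k → E → V), (∀ i, ContDiffOn ℝ ∞ (s i) W) ∧
      ∀ u ∈ W, LinearIndependent ℝ (fun i => s i u) ∧
        Submodule.span ℝ (Set.range fun i => s i u) = S u

/-- `r`-lightlike submanifold: the radical spaces form a smooth distribution of rank `r > 0`. -/
structure IsLightlike (B : LinearMap.BilinForm ℝ V) (F : E → V) (U : Set E) (r : ℕ) : Prop where
  isEmbedding : IsSmoothEmbedding U F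
  rank_pos : 0 < r
  smooth : IsSmoothSubbundle U (radSpace B F)
  rank : ∀ u ∈ U, Module.finrank ℝ (radSpace B F u) = r

/-- Coisotropic submanifold: the rank `r` of the radical distribution is the codimension. -/
structure IsCoisotropic (B : LinearMap.BilinForm ℝ V) (F : E → V) (U : Set E) (r : ℕ) : Prop where
  isLightlike : IsLightlike B F U r
  codim : Module.finrank ℝ V = Module.finrank ℝ E + r

/-- Underlying data of a choice of a screen distribution `S(TM)`, a screen transversal bundle
`S(TM^⊥)` and a lightlike transversal bundle `ltr(TM)`. -/
structure Screens (E V : Type*) [AddCommGroup V] [Module ℝ V] where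
  screen : E → Submodule ℝ V
  screenPerp : E → Submodule ℝ V
  ltr : E → Submodule ℝ V

/-- `tr(TM) = ltr(TM) ⊕ S(TM^⊥)`. -/
def Screens.tr (𝒮 : Screens E V) (u : E) : Submodule ℝ V :=
  𝒮.ltr u ⊔ 𝒮.screenPerp u

/-- `ξ` is a basis of the radical space at `u`, `N` is a basis of the fibre of `ltr(TM)` at `u`, and
`B (ξ i) (N j) = δ i j`, `B (N i) (N j) = 0`. -/
structure IsDualFrame (B : LinearMap.BilinForm ℝ V) (F : E → V) (𝒮 : Screens E V) (u : E)
    {r : ℕ} (ξ N : Fin r → V) : Prop where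
  ξ_indep : LinearIndependent ℝ ξ
  ξ_span : Submodule.span ℝ (Set.range ξ) = radSpace B F u
  N_span : Submodule.span ℝ (Set.range N) = 𝒮.ltr u
  pairing : ∀ i j, B (ξ i) (N j) = if i = j then 1 else 0
  N_null : ∀ i j, B (N i) (N j) = 0

/-- `S(TM)` is a complement of `Rad TM` in `TM` and `S(TM^⊥)` one of `Rad TM` in `TM^⊥` (such
complements are automatically nondegenerate); `ltr(TM)` is orthogonal to both and is locally
spanned by sections `N_i` dual to a local frame `ξ_i` of `Rad TM`. -/
structure IsScreens (B : LinearMap.BilinForm ℝ V) (F : E → V) (U : Set E) (r : ℕ)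
    (𝒮 : Screens E V) : Prop where
  screen_smooth : IsSmoothSubbundle U 𝒮.screen
  screen_disjoint : ∀ u ∈ U, Disjoint (radSpace B F u) (𝒮.screen u)
  screen_sup : ∀ u ∈ U, radSpace B F u ⊔ 𝒮.screen u = tangentSpace F u
  screenPerp_smooth : IsSmoothSubbundle U 𝒮.screenPerp
  screenPerp_disjoint : ∀ u ∈ U, Disjoint (radSpace B F u) (𝒮.screenPerp u)
  screenPerp_sup : ∀ u ∈ U, radSpace B F u ⊔ 𝒮.screenPerp u = perp B (tangentSpace F u)
  ltr_orthogonal : ∀ u ∈ U, 𝒮.ltr u ≤ perp B (𝒮.screen u) ⊓ perp B (𝒮.screenPerp u)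
  ltr_frame : ∀ u₀ ∈ U, ∃ W : Set E, IsOpen W ∧ u₀ ∈ W ∧ W ⊆ U ∧
    ∃ ξ N : Fin r → E → V, (∀ i, ContDiffOn ℝ ∞ (ξ i) W) ∧ (∀ i, ContDiffOn ℝ ∞ (N i) W) ∧
      ∀ u ∈ W, IsDualFrame B F 𝒮 u (fun i => ξ i u) (fun i => N i u)

open Classical in
/-- The tangential part of an ambient vector with respect to `V = T_u M ⊕ tr(T_u M)`, as an element
of the coordinate space `E`. -/
def tangentialPart (F : E → V) (𝒮 : Screens E V) (u : E) : V →ₗ[ℝ] E :=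
  if hb : Function.Bijective
      (LinearMap.coprod (fderiv ℝ F u).toLinearMap (𝒮.tr u).subtype) then
    LinearMap.fst ℝ E (𝒮.tr u) ∘ₗ (LinearEquiv.ofBijective _ hb).symm.toLinearMap
  else 0

/-- The induced connection `∇_X Y`: the tangential part of the flat derivative along `X` of the
vector field `Y`, considered as a field of ambient vectors. -/
def connection (F : E → V) (𝒮 : Screens E V) (X Y : E → E) (u : E) : E :=
  tangentialPart F 𝒮 u (fderiv ℝ (fun q => fderiv ℝ F q (Y q)) u (X u))

/-- `R(X, Y) Z = ∇_X ∇_Y Z - ∇_Y ∇_X Z - ∇_[X,Y] Z`. -/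
def curvature (F : E → V) (𝒮 : Screens E V) (X Y Z : E → E) (u : E) : E :=
  connection F 𝒮 X (connection F 𝒮 Y Z) u - connection F 𝒮 Y (connection F 𝒮 X Z) u
    - connection F 𝒮 (VectorField.lieBracket ℝ X Y) Z u

/-- The value at `u` of `R(x, y) z` for tangent vectors; by tensoriality, they may be extended to
vector fields with constant components in the chart. -/
def curvatureAt (F : E → V) (𝒮 : Screens E V) (u x y z : E) : E :=
  curvature F 𝒮 (fun _ => x) (fun _ => y) (fun _ => z) u

/-- The `(0,4)`-tensor `R(x, y, z, w) = g(R(x, y) z, w)` on `T_u M` of the induced connection. -/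
def IsInducedCurvature (B : LinearMap.BilinForm ℝ V) (F : E → V) (𝒮 : Screens E V) (u : E)
    (R : E →ₗ[ℝ] E →ₗ[ℝ] E →ₗ[ℝ] E →ₗ[ℝ] ℝ) : Prop :=
  ∀ x y z w, R x y z w = inducedMetric B F u (curvatureAt F 𝒮 u x y z) w

/-- Algebraic curvature maps. -/
structure IsAlgebraicCurvature (R : E →ₗ[ℝ] E →ₗ[ℝ] E →ₗ[ℝ] E →ₗ[ℝ] ℝ) : Prop where
  skew : ∀ x y z w, R x y z w = -R y x z w
  pair : ∀ x y z w, R x y z w = R z w x y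
  bianchi : ∀ x y z w, R x y z w + R y z x w + R z x y w = 0

/-- Admissible screens: the induced curvature is an algebraic curvature tensor at every point. -/
structure IsAdmissible (B : LinearMap.BilinForm ℝ V) (F : E → V) (U : Set E) (r : ℕ)
    (𝒮 : Screens E V) : Prop where
  isScreens : IsScreens B F U r 𝒮
  algebraic : ∀ u ∈ U, ∃ R, IsInducedCurvature B F 𝒮 u R ∧ IsAlgebraicCurvature R

/-- The associated metric `g̃ = g + ∑ η_i ⊗ η_i` at `u`, where `η_i(X) = B(N_i, X)`. -/
def associatedMetric (B : LinearMap.BilinForm ℝ V) (F : E → V) (u : E) {r : ℕ} (N : Fin r → V) :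
    LinearMap.BilinForm ℝ E :=
  inducedMetric B F u +
    ∑ i, LinearMap.BilinForm.linMulLin
      ((B (N i)) ∘ₗ (fderiv ℝ F u).toLinearMap) ((B (N i)) ∘ₗ (fderiv ℝ F u).toLinearMap)

/-- `J` is the pseudo-Jacobi operator `J_R(x)` for the nondegenerate metric `gt`:
`gt(J y, w) = R(y, x, x, w)`. -/
def IsPseudoJacobi (gt : LinearMap.BilinForm ℝ E) (R : E →ₗ[ℝ] E →ₗ[ℝ] E →ₗ[ℝ] E →ₗ[ℝ] ℝ)
    (x : E) (J : Module.End ℝ E) : Prop :=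
  ∀ y w, gt (J y) w = R y x x w

/-- At the point `u` the pseudo-Jacobi operator of the induced curvature with respect to `x` (for
any dual frames `ξ`, `N` used to form the associated metric) exists and has the characteristic
polynomial `P`. -/
def HasPseudoJacobiCharpoly (B : LinearMap.BilinForm ℝ V) (F : E → V) (r : ℕ) (𝒮 : Screens E V)
    [FiniteDimensional ℝ E] (u x : E) (P : Polynomial ℝ) : Prop :=
  ∀ R, IsInducedCurvature B F 𝒮 u R → ∀ ξ N : Fin r → V, IsDualFrame B F 𝒮 u ξ N →
    (∃ J, IsPseudoJacobi (associatedMetric B F u N) R x J) ∧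
    ∀ J, IsPseudoJacobi (associatedMetric B F u N) R x J → J.charpoly = P

/-- Globally Osserman: for all admissible screens, the characteristic polynomial of `J_R(x)` does
not depend on the unit spacelike vector `x`, nor on the unit timelike vector `x`, nor on the
point. -/
def IsGloballyOsserman (B : LinearMap.BilinForm ℝ V) (F : E → V) (U : Set E) (r : ℕ)
    [FiniteDimensional ℝ E] : Prop :=
  ∀ 𝒮 : Screens E V, IsAdmissible B F U r 𝒮 → ∀ ε : ℝ, ε = 1 ∨ ε = -1 →
    ∃ P : Polynomial ℝ, ∀ u ∈ U, ∀ x : E, inducedMetric B F u x x = ε →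
      HasPseudoJacobiCharpoly B F r 𝒮 u x P

end General

section Example

/-! ## The metric `g_(f,h)` on `ℝ × 𝒪 × ℝ^(p+1)` -/

/-- Coordinates `(x, y) = (x_0, …, x_p, y_0, …, y_p)`. -/
abbrev Coord (p : ℕ) : Type := (Fin (p + 1) → ℝ) × (Fin (p + 1) → ℝ)

/-- The ambient space, with coordinates with respect to the basis
`u_0, …, u_p, v_0, …, v_p, w_1, w_2`. -/
abbrev Ambient (p : ℕ) : Type := (Fin (p + 1) → ℝ) × (Fin (p + 1) → ℝ) × ℝ × ℝ

/-- `a ⊗ b + b ⊗ a`. -/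
def symProd {W : Type*} [AddCommGroup W] [Module ℝ W] (a b : W →ₗ[ℝ] ℝ) :
    LinearMap.BilinForm ℝ W :=
  LinearMap.BilinForm.linMulLin a b + LinearMap.BilinForm.linMulLin b a

/-- `dx_i` -/
def dx {p : ℕ} (i : Fin (p + 1)) : Coord p →ₗ[ℝ] ℝ :=
  LinearMap.proj i ∘ₗ LinearMap.fst ℝ (Fin (p + 1) → ℝ) (Fin (p + 1) → ℝ)

/-- `dy_i` -/
def dy {p : ℕ} (i : Fin (p + 1)) : Coord p →ₗ[ℝ] ℝ :=
  LinearMap.proj i ∘ₗ LinearMap.snd ℝ (Fin (p + 1) → ℝ) (Fin (p + 1) → ℝ)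

/-- The partial derivative `∂f/∂x_i` for a function of `(x_1, …, x_p)`. -/
def pd {p : ℕ} (f : (Fin p → ℝ) → ℝ) (i : Fin p) (a : Fin p → ℝ) : ℝ :=
  fderiv ℝ f a (Pi.single i 1)

/-- `M = ℝ × 𝒪 × ℝ^(p+1)`: the points with `(x_1, …, x_p) ∈ 𝒪`. -/
def domain {p : ℕ} (O : Set (Fin p → ℝ)) : Set (Coord p) :=
  {q | Fin.tail q.1 ∈ O}

/-- The metric `g_(f,h)`. -/
def metricFH {p : ℕ} (f h : (Fin p → ℝ) → ℝ) (q : Coord p) : LinearMap.BilinForm ℝ (Coord p) :=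
  ∑ i : Fin p, (pd f i (Fin.tail q.1) • symProd (dx 0) (dx i.succ)
      + pd h i (Fin.tail q.1) • symProd (dx i.succ) (dy 0))
  + ∑ i : Fin p, ∑ j : Fin p,
      (pd f i (Fin.tail q.1) * pd f j (Fin.tail q.1)
        + pd h i (Fin.tail q.1) * pd h j (Fin.tail q.1)) •
        LinearMap.BilinForm.linMulLin (dx i.succ) (dx j.succ)
  + ∑ i : Fin p, symProd (dx i.succ) (dy i.succ)

/-- Coordinate along `u_i`. -/
def cu {p : ℕ} (i : Fin (p + 1)) : Ambient p →ₗ[ℝ] ℝ :=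
  LinearMap.proj i ∘ₗ LinearMap.fst ℝ (Fin (p + 1) → ℝ) ((Fin (p + 1) → ℝ) × ℝ × ℝ)

/-- Coordinate along `v_i`. -/
def cv {p : ℕ} (i : Fin (p + 1)) : Ambient p →ₗ[ℝ] ℝ :=
  LinearMap.proj i ∘ₗ LinearMap.fst ℝ (Fin (p + 1) → ℝ) (ℝ × ℝ) ∘ₗ
    LinearMap.snd ℝ (Fin (p + 1) → ℝ) ((Fin (p + 1) → ℝ) × ℝ × ℝ)

/-- Coordinate along `w_1`. -/
def cw₁ {p : ℕ} : Ambient p →ₗ[ℝ] ℝ :=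
  LinearMap.fst ℝ ℝ ℝ ∘ₗ LinearMap.snd ℝ (Fin (p + 1) → ℝ) (ℝ × ℝ) ∘ₗ
    LinearMap.snd ℝ (Fin (p + 1) → ℝ) ((Fin (p + 1) → ℝ) × ℝ × ℝ)

/-- Coordinate along `w_2`. -/
def cw₂ {p : ℕ} : Ambient p →ₗ[ℝ] ℝ :=
  LinearMap.snd ℝ ℝ ℝ ∘ₗ LinearMap.snd ℝ (Fin (p + 1) → ℝ) (ℝ × ℝ) ∘ₗ
    LinearMap.snd ℝ (Fin (p + 1) → ℝ) ((Fin (p + 1) → ℝ) × ℝ × ℝ)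

/-- The ambient metric: the nonzero products of basis vectors are `u_i · v_i = 1` for
`1 ≤ i ≤ p`, `u_0 · w_1 = 1`, `v_0 · w_2 = 1`, `w_1 · w_1 = 1`, `w_2 · w_2 = 1`. -/
def ambientMetric (p : ℕ) : LinearMap.BilinForm ℝ (Ambient p) :=
  ∑ i : Fin p, symProd (cu i.succ) (cv i.succ) + symProd (cu 0) cw₁ + symProd (cv 0) cw₂
    + LinearMap.BilinForm.linMulLin cw₁ cw₁ + LinearMap.BilinForm.linMulLin cw₂ cw₂

/-- `F(x, y) = ∑ x_i u_i + ∑ y_i v_i + f w_1 + h w_2`. -/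
def embFH {p : ℕ} (f h : (Fin p → ℝ) → ℝ) (q : Coord p) : Ambient p :=
  (q.1, q.2, f (Fin.tail q.1), h (Fin.tail q.1))

/-- `ξ_1 = ∂/∂x_0 - ∑ (∂f/∂x_i) ∂/∂y_i`. -/
def xi₁ {p : ℕ} (f : (Fin p → ℝ) → ℝ) (q : Coord p) : Coord p :=
  (Pi.single 0 1, Fin.cons 0 fun i => -pd f i (Fin.tail q.1))

/-- `ξ_2 = ∂/∂y_0 - ∑ (∂h/∂x_i) ∂/∂y_i`. -/
def xi₂ {p : ℕ} (h : (Fin p → ℝ) → ℝ) (q : Coord p) : Coord p :=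
  (0, Fin.cons 1 fun i => -pd h i (Fin.tail q.1))

/-- `U_i = ∂/∂x_i - (∂f/∂x_i) ∂/∂x_0 - (∂h/∂x_i) ∂/∂y_0`. -/
def fieldU {p : ℕ} (f h : (Fin p → ℝ) → ℝ) (i : Fin p) (q : Coord p) : Coord p :=
  (Pi.single i.succ 1 - pd f i (Fin.tail q.1) • Pi.single 0 1,
    -(pd h i (Fin.tail q.1) • Pi.single 0 1))

/-- `V_i = ∂/∂y_i`. -/
def fieldV {p : ℕ} (i : Fin p) : Coord p :=
  (0, Pi.single i.succ 1)

/-- `N_1 = w_1 - ξ_1 / 2`. -/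
def trans₁ {p : ℕ} (f h : (Fin p → ℝ) → ℝ) (q : Coord p) : Ambient p :=
  (0, 0, 1, 0) - (1 / 2 : ℝ) • fderiv ℝ (embFH f h) q (xi₁ f q)

/-- `N_2 = w_2 - ξ_2 / 2`. -/
def trans₂ {p : ℕ} (f h : (Fin p → ℝ) → ℝ) (q : Coord p) : Ambient p :=
  (0, 0, 0, 1) - (1 / 2 : ℝ) • fderiv ℝ (embFH f h) q (xi₂ h q)

/-- `S(TM) = Span {U_i, V_i}`, `S(TM^⊥) = 0`, `ltr(TM) = Span {N_1, N_2}`. -/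
def screensFH {p : ℕ} (f h : (Fin p → ℝ) → ℝ) : Screens (Coord p) (Ambient p) where
  screen q := Submodule.span ℝ
    ((Set.range fun i : Fin p => fderiv ℝ (embFH f h) q (fieldU f h i q)) ∪
      Set.range fun i : Fin p => fderiv ℝ (embFH f h) q (fieldV i))
  screenPerp _ := ⊥
  ltr q := Submodule.span ℝ {trans₁ f h q, trans₂ f h q}

end Example

end LightlikeOsserman

end

/-!
The image under `dF` of the constant fields `∂_{x_0}, ∂_{y_0}, …, ∂_{y_p}` is locally constant, so
these fields are parallel for every choice of screens, and the curvature vanishes as soon as one of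
them is inserted. Their span `K` contains its own orthogonal for the induced metric. Hence every
pseudo-Jacobi operator maps into `K` and annihilates `K`; its square is zero, whatever the screens.

For the canonical screens, the second derivative of `F` takes values in `span {w_1, w_2}` and
`w_i = N_i + ξ_i / 2`. The Christoffel term of the induced connection is therefore radical, and the
curvature is one half of the Gauss tensor of the second derivative, which is an algebraic curvature
tensor.
-/

namespace LightlikeOsserman

section DualFamilies

variable {ι R M N : Type*} [CommRing R] [AddCommGroup M] [Module R M] [AddCommGroup N] [Module R N]
  [DecidableEq ι] {b : M →ₗ[R] N →ₗ[R] R} {v : ι → M} {w : ι → N}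

theorem linearIndependent_of_dual_pairing (hvw : ∀ i j, b (v i) (w j) = if i = j then 1 else 0) :
    LinearIndependent R v :=
  .of_pairwise_dual_eq_zero_one v (fun j => b.flip (w j))
    (fun i j hij => by simp [hvw, hij.symm]) (fun i => by simp [hvw])

theorem eq_sum_of_mem_span_of_dual_pairing [Fintype ι]
    (hvw : ∀ i j, b (v i) (w j) = if i = j then 1 else 0) {x : M}
    (hx : x ∈ Submodule.span R (Set.range v)) : x = ∑ j, b x (w j) • v j := by
  obtain ⟨c, rfl⟩ := (Submodule.mem_span_range_iff_exists_fun R).mp hx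
  simp [LinearMap.sum_apply, hvw]

theorem eq_zero_of_mem_span_of_dual_pairing [Finite ι]
    (hvw : ∀ i j, b (v i) (w j) = if i = j then 1 else 0) {x : M}
    (hx : x ∈ Submodule.span R (Set.range v)) (hxw : ∀ j, b x (w j) = 0) : x = 0 := by
  have := Fintype.ofFinite ι
  rw [eq_sum_of_mem_span_of_dual_pairing hvw hx]
  simp [hxw]

end DualFamilies

theorem sigPos_eq_sigNeg_of_antiIsometry {V : Type*} [AddCommGroup V] [Module ℝ V]
    {Q : QuadraticForm ℝ V} (e : V ≃ₗ[ℝ] V) (he : ∀ v, Q (e v) = -Q v) :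
    sigPos Q = sigNeg Q := by
  rw [← sigPos_neg]
  exact QuadraticMap.Equivalent.sigPos_eq ⟨{ e with map_app' v := by simp [he] }⟩

theorem isSemiEuclidean_of_antiIsometry {V : Type*} [NormedAddCommGroup V] [NormedSpace ℝ V]
    [FiniteDimensional ℝ V] {B : LinearMap.BilinForm ℝ V} (hB : B.IsSymm) (hnd : B.Nondegenerate)
    (e : V ≃ₗ[ℝ] V) (he : ∀ v, B.toQuadraticMap (e v) = -B.toQuadraticMap v) {n : ℕ}
    (hn : Module.finrank ℝ V = 2 * n) : IsSemiEuclidean B n n := by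
  have heq := sigPos_eq_sigNeg_of_antiIsometry e he
  have hradical : B.toQuadraticMap.radical = ⊥ := by
    rw [QuadraticMap.radical_eq_ker_associated, QuadraticMap.associated_left_inverse ℝ hB.eq,
      ← LinearMap.separatingLeft_iff_ker_eq_bot]
    exact hnd.1
  have hsum := QuadraticForm.sigPos_add_sigNeg_add_radical (Q := B.toQuadraticMap)
  rw [hradical, finrank_bot] at hsum
  exact ⟨hB, hnd, by lia, by lia⟩

section AlgebraicCurvature

variable {E V : Type*} [NormedAddCommGroup E] [NormedSpace ℝ E] [AddCommGroup V] [Module ℝ V]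

theorem IsAlgebraicCurvature.smul {R : E →ₗ[ℝ] E →ₗ[ℝ] E →ₗ[ℝ] E →ₗ[ℝ] ℝ}
    (hR : IsAlgebraicCurvature R) (c : ℝ) : IsAlgebraicCurvature (c • R) where
  skew x y z w := by simp [hR.skew x y z w]
  pair x y z w := by simp [hR.pair x y z w]
  bianchi x y z w := by
    simp only [LinearMap.smul_apply, ← smul_add, hR.bianchi x y z w, smul_zero]

/-- The `(0, 4)`-tensor `B (h x z) (h y w) - B (h y z) (h x w)` which the Gauss equation attaches to
a `V`-valued second fundamental form `h`. -/
def gaussTensor (B : LinearMap.BilinForm ℝ V) (h : E →ₗ[ℝ] E →ₗ[ℝ] V) :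
    E →ₗ[ℝ] E →ₗ[ℝ] E →ₗ[ℝ] E →ₗ[ℝ] ℝ :=
  LinearMap.mk₂ ℝ (fun x y => B.compl₁₂ (h x) (h y) - B.compl₁₂ (h y) (h x))
    (fun _ _ _ => by
      ext
      simp only [map_add, LinearMap.sub_apply, LinearMap.compl₁₂_apply, LinearMap.add_apply]
      ring)
    (fun _ _ _ => by
      ext
      simp only [map_smul, LinearMap.sub_apply, LinearMap.compl₁₂_apply, LinearMap.smul_apply,
        smul_eq_mul]
      ring)
    (fun _ _ _ => by
      ext
      simp only [map_add, LinearMap.sub_apply, LinearMap.compl₁₂_apply, LinearMap.add_apply]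
      ring)
    (fun _ _ _ => by
      ext
      simp only [map_smul, LinearMap.sub_apply, LinearMap.compl₁₂_apply, LinearMap.smul_apply,
        smul_eq_mul]
      ring)

theorem gaussTensor_apply (B : LinearMap.BilinForm ℝ V) (h : E →ₗ[ℝ] E →ₗ[ℝ] V) (x y z w : E) :
    gaussTensor B h x y z w = B (h x z) (h y w) - B (h y z) (h x w) :=
  rfl

theorem isAlgebraicCurvature_gaussTensor {B : LinearMap.BilinForm ℝ V} (hB : B.IsSymm)
    {h : E →ₗ[ℝ] E →ₗ[ℝ] V} (hh : ∀ x y, h x y = h y x) :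
    IsAlgebraicCurvature (gaussTensor B h) where
  skew x y z w := by simp only [gaussTensor_apply]; ring
  pair x y z w := by
    simp only [gaussTensor_apply]
    rw [hh x z, hh y w, hh y z, hh x w, hB.eq (h z y)]
  bianchi x y z w := by
    simp only [gaussTensor_apply]
    rw [hh y x, hh z x, hh z y]
    ring

end AlgebraicCurvature

section PseudoJacobi

variable {E : Type*} [NormedAddCommGroup E] [NormedSpace ℝ E] {G : LinearMap.BilinForm ℝ E}
  {R : E →ₗ[ℝ] E →ₗ[ℝ] E →ₗ[ℝ] E →ₗ[ℝ] ℝ} {x : E}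

theorem existsUnique_isPseudoJacobi [FiniteDimensional ℝ E] (hG : G.Nondegenerate)
    (R : E →ₗ[ℝ] E →ₗ[ℝ] E →ₗ[ℝ] E →ₗ[ℝ] ℝ) (x : E) : ∃! J, IsPseudoJacobi G R x J := by
  refine ⟨(G.toDual hG).symm.toLinearMap ∘ₗ (R.flip x).flip x, fun y w => ?_, fun J hJ => ?_⟩
  · simp [LinearMap.BilinForm.apply_toDual_symm_apply]
  · ext1 y
    apply (G.toDual hG).injective
    ext w
    simp [LinearMap.BilinForm.toDual_def, hJ y w]

theorem IsPseudoJacobi.sq_eq_zero {J : Module.End ℝ E} (hJ : IsPseudoJacobi G R x J)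
    (hG : G.Nondegenerate) (hR : IsAlgebraicCurvature R) {K : Submodule ℝ E}
    (hK : ∀ v, (∀ k ∈ K, G v k = 0) → v ∈ K) (hRK : ∀ x y w, ∀ k ∈ K, R x y k w = 0) :
    J ^ 2 = 0 := by
  have hJK (y : E) : J y ∈ K :=
    hK _ fun k hk => by rw [hJ, hR.pair, hR.skew, hR.pair, hRK _ _ _ k hk, neg_zero]
  ext y
  rw [pow_two, Module.End.mul_apply, LinearMap.zero_apply]
  exact hG.1 _ fun w => by rw [hJ, hR.pair, hRK _ _ _ _ (hJK y)]

end PseudoJacobi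

section Submanifold

variable {E V : Type*} [NormedAddCommGroup E] [NormedSpace ℝ E]
  [NormedAddCommGroup V] [NormedSpace ℝ V] {B : LinearMap.BilinForm ℝ V} {F : E → V} {U : Set E}
  {u : E}

theorem inducedMetric_apply (B : LinearMap.BilinForm ℝ V) (F : E → V) (u v w : E) :
    inducedMetric B F u v w = B (fderiv ℝ F u v) (fderiv ℝ F u w) :=
  rfl

theorem radSpace_eq_map_ker (hB : B.IsSymm) (F : E → V) (u : E) :
    radSpace B F u =
      (LinearMap.ker (inducedMetric B F u)).map (fderiv ℝ F u).toLinearMap := by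
  ext v
  simp only [radSpace, perp, tangentSpace, Submodule.mem_inf,
    LinearMap.BilinForm.mem_orthogonal_iff, LinearMap.mem_range, forall_exists_index,
    forall_apply_eq_imp_iff, Submodule.mem_map, LinearMap.mem_ker, LinearMap.ext_iff]
  constructor
  · rintro ⟨⟨k, rfl⟩, hk⟩
    exact ⟨k, fun w => (hB.eq _ _).trans (hk w), rfl⟩
  · rintro ⟨k, hk, rfl⟩
    exact ⟨⟨k, rfl⟩, fun w => (hB.eq _ _).trans (hk w)⟩

theorem finrank_radSpace (hB : B.IsSymm) (hF : Function.Injective (fderiv ℝ F u)) :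
    Module.finrank ℝ (radSpace B F u) =
      Module.finrank ℝ (LinearMap.ker (inducedMetric B F u)) := by
  rw [radSpace_eq_map_ker hB]
  exact (Submodule.equivMapOfInjective _ hF _).finrank_eq.symm

theorem finrank_perp_tangentSpace [FiniteDimensional ℝ V] (hB : B.Nondegenerate) {r : ℕ}
    (hF : Function.Injective (fderiv ℝ F u))
    (hcodim : Module.finrank ℝ V = Module.finrank ℝ E + r) :
    Module.finrank ℝ (perp B (tangentSpace F u)) = r := by
  have := LinearMap.BilinForm.finrank_orthogonal hB (tangentSpace F u)
  rwa [tangentSpace, LinearMap.finrank_range_of_inj hF, hcodim, Nat.add_sub_cancel_left] at this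

theorem isSmoothSubbundle_of_frame {ι : Type*} [Finite ι] (hU : IsOpen U) {S : E → Submodule ℝ V}
    {s : ι → E → V} (hs : ∀ i, ContDiffOn ℝ ∞ (s i) U)
    (hli : ∀ u ∈ U, LinearIndependent ℝ fun i => s i u)
    (hspan : ∀ u ∈ U, Submodule.span ℝ (Set.range fun i => s i u) = S u) :
    IsSmoothSubbundle U S := by
  have := Fintype.ofFinite ι
  let e : Fin (Fintype.card ι) ≃ ι := (Fintype.equivFin ι).symm
  refine fun u₀ hu₀ => ⟨U, hU, hu₀, subset_rfl, _, fun i => s (e i), fun i => hs _,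
    fun u hu => ⟨(hli u hu).comp _ e.injective, ?_⟩⟩
  rw [← hspan u hu]
  exact congrArg _ (e.surjective.range_comp fun i => s i u)

theorem IsSmoothEmbedding.contDiffOn_fderiv_apply (hF : IsSmoothEmbedding U F) {Y : E → E}
    (hY : ContDiffOn ℝ ∞ Y U) : ContDiffOn ℝ ∞ (fun u => fderiv ℝ F u (Y u)) U :=
  (hF.smooth.fderiv_of_isOpen hF.isOpen (by simp)).clm_apply hY

theorem differentiableAt_fderiv_of_contDiffOn (hF : ContDiffOn ℝ ∞ F U) (hU : IsOpen U)
    (hu : u ∈ U) : DifferentiableAt ℝ (fderiv ℝ F) u :=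
  ((hF.fderiv_of_isOpen (m := ∞) hU (by simp)).contDiffAt (hU.mem_nhds hu)).differentiableAt
    (by simp)

theorem IsSmoothEmbedding.differentiableAt_fderiv (hF : IsSmoothEmbedding U F) (hu : u ∈ U) :
    DifferentiableAt ℝ (fderiv ℝ F) u :=
  differentiableAt_fderiv_of_contDiffOn hF.smooth hF.isOpen hu

section DualFrame

variable {𝒮 : Screens E V} {r : ℕ} {ξ N : Fin r → V}

theorem associatedMetric_apply (B : LinearMap.BilinForm ℝ V) (F : E → V) (u : E)
    (N : Fin r → V) (v w : E) :
    associatedMetric B F u N v w = inducedMetric B F u v w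
      + ∑ i, B (N i) (fderiv ℝ F u v) * B (N i) (fderiv ℝ F u w) := by
  simp [associatedMetric, LinearMap.sum_apply]

theorem isSymm_associatedMetric (hB : B.IsSymm) (F : E → V) (u : E) (N : Fin r → V) :
    (associatedMetric B F u N).IsSymm where
  eq v w := by
    simp only [associatedMetric_apply, inducedMetric_apply]
    rw [hB.eq]
    simp only [mul_comm]

theorem IsDualFrame.apply_N_eq_zero (hN : IsDualFrame B F 𝒮 u ξ N) (hB : B.IsSymm) {v : E}
    (hv : ∀ k ∈ LinearMap.ker (inducedMetric B F u), associatedMetric B F u N v k = 0) (i : Fin r) :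
    B (N i) (fderiv ℝ F u v) = 0 := by
  have hξ : ξ i ∈ radSpace B F u := hN.ξ_span ▸ Submodule.subset_span ⟨i, rfl⟩
  rw [radSpace_eq_map_ker hB] at hξ
  obtain ⟨k, hk, hkξ : fderiv ℝ F u k = ξ i⟩ := hξ
  have hvk : inducedMetric B F u v k = 0 := (hB.eq _ _).trans (LinearMap.congr_fun hk v)
  have hη (j : Fin r) : B (N j) (fderiv ℝ F u k) = if i = j then 1 else 0 := by
    rw [hkξ, hB.eq, hN.pairing]
  simpa [associatedMetric_apply, hvk, hη] using hv k hk

theorem IsDualFrame.nondegenerate_associatedMetric (hN : IsDualFrame B F 𝒮 u ξ N) (hB : B.IsSymm)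
    (hF : Function.Injective (fderiv ℝ F u)) : (associatedMetric B F u N).Nondegenerate := by
  refine (isSymm_associatedMetric hB F u N).isRefl.nondegenerate_iff_separatingLeft.mpr
    fun v hv => ?_
  have hη (i : Fin r) : B (N i) (fderiv ℝ F u v) = 0 := hN.apply_N_eq_zero hB (fun k _ => hv k) i
  have hker : inducedMetric B F u v = 0 := by
    ext w
    simpa [associatedMetric_apply, hη] using hv w
  have hrad : fderiv ℝ F u v ∈ Submodule.span ℝ (Set.range ξ) := by
    rw [hN.ξ_span, radSpace_eq_map_ker hB]
    exact ⟨v, hker, rfl⟩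
  have hFv : fderiv ℝ F u v = 0 :=
    eq_zero_of_mem_span_of_dual_pairing hN.pairing hrad fun i => (hB.eq _ _).trans (hη i)
  exact hF (hFv.trans (map_zero _).symm)

/-- For `g̃ = g + ∑ η_i ⊗ η_i` the radical of `g` is dual to the `η_i`, so on vectors that are
`g̃`-orthogonal to it the two metrics agree. -/
theorem IsDualFrame.mem_of_associatedMetric_eq_zero (hN : IsDualFrame B F 𝒮 u ξ N) (hB : B.IsSymm)
    {K : Submodule ℝ E} (hK : (inducedMetric B F u).orthogonal K ≤ K) {v : E}
    (hv : ∀ k ∈ K, associatedMetric B F u N v k = 0) : v ∈ K := by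
  have hker : LinearMap.ker (inducedMetric B F u) ≤ K := fun k hk =>
    hK fun w _ => (hB.eq _ _).trans (LinearMap.congr_fun hk w)
  have hη := hN.apply_N_eq_zero hB fun k hk => hv k (hker hk)
  refine hK fun k hk => (hB.eq _ _).trans ?_
  simpa [associatedMetric_apply, hη, inducedMetric_apply] using hv k hk

end DualFrame

section Connection

variable {𝒮 : Screens E V}

theorem fderiv_fderiv_apply (hF : DifferentiableAt ℝ (fderiv ℝ F) u) (y z : E) :
    fderiv ℝ (fun q => fderiv ℝ F q z) u y = fderiv ℝ (fderiv ℝ F) u y z := by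
  simp [fderiv_clm_apply hF (differentiableAt_const z)]

theorem tangentialPart_eq (hb : Function.Bijective
      (LinearMap.coprod (fderiv ℝ F u).toLinearMap (𝒮.tr u).subtype)) (v : E) {t : V}
    (ht : t ∈ 𝒮.tr u) : tangentialPart F 𝒮 u (fderiv ℝ F u v + t) = v := by
  have himage : fderiv ℝ F u v + t = LinearEquiv.ofBijective _ hb (v, ⟨t, ht⟩) := by simp
  rw [tangentialPart, dif_pos hb, himage, LinearMap.comp_apply, LinearEquiv.coe_coe,
    LinearEquiv.symm_apply_apply, LinearMap.fst_apply]

theorem connection_congr {X Y Y' : E → E} (h : Y =ᶠ[nhds u] Y') :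
    connection F 𝒮 X Y u = connection F 𝒮 X Y' u := by
  have hFY : (fun q => fderiv ℝ F q (Y q)) =ᶠ[nhds u] fun q => fderiv ℝ F q (Y' q) :=
    h.mono fun q hq => by simp only [hq]
  rw [connection, connection, hFY.fderiv_eq]

theorem curvatureAt_eq_sub (F : E → V) (𝒮 : Screens E V) (u x y z : E) :
    curvatureAt F 𝒮 u x y z =
      connection F 𝒮 (fun _ => x) (connection F 𝒮 (fun _ => y) fun _ => z) u
        - connection F 𝒮 (fun _ => y) (connection F 𝒮 (fun _ => x) fun _ => z) u := by
  rw [curvatureAt, curvature, sub_eq_self]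
  simp [connection, VectorField.lieBracket]

theorem curvatureAt_eq_zero_of_eventually_fderiv_eq {z : E}
    (hz : ∀ᶠ q in nhds u, fderiv ℝ F q z = fderiv ℝ F u z) (x y : E) :
    curvatureAt F 𝒮 u x y z = 0 := by
  have hparallel (y : E) :
      connection F 𝒮 (fun _ => y) (fun _ => z) =ᶠ[nhds u] fun _ => 0 := by
    filter_upwards [hz.eventually_nhds] with q hq
    have hconst : (fun q => fderiv ℝ F q z) =ᶠ[nhds q] fun _ => fderiv ℝ F u z := hq
    simp [connection, hconst.fderiv_eq]
  rw [curvatureAt_eq_sub, connection_congr (hparallel y), connection_congr (hparallel x)]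
  simp [connection]

theorem IsInducedCurvature.unique {R R' : E →ₗ[ℝ] E →ₗ[ℝ] E →ₗ[ℝ] E →ₗ[ℝ] ℝ}
    (hR : IsInducedCurvature B F 𝒮 u R) (hR' : IsInducedCurvature B F 𝒮 u R') : R = R' := by
  ext x y z w
  rw [hR, hR']

theorem connection_eq_fderiv
    (hb : Function.Bijective (LinearMap.coprod (fderiv ℝ F u).toLinearMap (𝒮.tr u).subtype))
    (hF : DifferentiableAt ℝ (fderiv ℝ F) u) {X Y : E → E} (hY : DifferentiableAt ℝ Y u)
    (hXY : fderiv ℝ (fderiv ℝ F) u (X u) (Y u) = 0) :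
    connection F 𝒮 X Y u = fderiv ℝ Y u (X u) := by
  rw [connection, fderiv_clm_apply hF hY]
  simpa [hXY] using tangentialPart_eq hb (fderiv ℝ Y u (X u)) (zero_mem _)

theorem inducedMetric_fderiv_of_mem_ker [FiniteDimensional ℝ V]
    (hF : DifferentiableAt ℝ (fderiv ℝ F) u) {Y : E → E} (hY : DifferentiableAt ℝ Y u)
    (hYker : ∀ᶠ q in nhds u, Y q ∈ LinearMap.ker (inducedMetric B F q)) {x : E}
    (hxY : fderiv ℝ (fderiv ℝ F) u x (Y u) = 0) (w : E) :
    inducedMetric B F u (fderiv ℝ Y u x) w =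
      -B (fderiv ℝ F u (Y u)) (fderiv ℝ (fderiv ℝ F) u x w) := by
  have hzero : (fun q => LinearMap.toContinuousBilinearMap B (fderiv ℝ F q (Y q)) (fderiv ℝ F q w))
      =ᶠ[nhds u] fun _ => 0 := hYker.mono fun q hq => LinearMap.congr_fun hq w
  have hproduct := DFunLike.congr_fun (hzero.fderiv_eq (𝕜 := ℝ)) x
  rw [ContinuousLinearMap.fderiv_of_bilinear _ (hF.clm_apply hY)
    (hF.clm_apply (differentiableAt_const w)), fderiv_clm_apply hF hY,
    fderiv_clm_apply hF (differentiableAt_const w)] at hproduct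
  simp only [ContinuousLinearMap.precompR_apply, ContinuousLinearMap.precompL_apply,
    ContinuousLinearMap.compL_apply, ContinuousLinearMap.comp_apply, ContinuousLinearMap.flip_apply,
    LinearMap.toContinuousBilinearMap_apply, fderiv_fun_const, Pi.zero_apply,
    ContinuousLinearMap.comp_zero, add_apply, zero_apply, map_add, map_zero, zero_add, add_zero,
    hxY] at hproduct
  rw [inducedMetric_apply]
  linarith

end Connection

/-- A subspace of the chart that is coisotropic for the induced metric at every point of `U` and
whose vectors have locally constant ambient images, so that they are parallel vector fields for the
induced connection of any screens. -/
structure IsParallelCoisotropic (B : LinearMap.BilinForm ℝ V) (F : E → V) (U : Set E)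
    (K : Submodule ℝ E) : Prop where
  orthogonal_le : ∀ u ∈ U, (inducedMetric B F u).orthogonal K ≤ K
  eventually_fderiv_eq : ∀ u ∈ U, ∀ k ∈ K, ∀ᶠ q in nhds u, fderiv ℝ F q k = fderiv ℝ F u k

namespace IsParallelCoisotropic

variable {K : Submodule ℝ E} {𝒮 : Screens E V} {r : ℕ} {ξ N : Fin r → V}
  {R : E →ₗ[ℝ] E →ₗ[ℝ] E →ₗ[ℝ] E →ₗ[ℝ] ℝ}

theorem isNilpotent_pseudoJacobi (hK : IsParallelCoisotropic B F U K) (hB : B.IsSymm) (hu : u ∈ U)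
    (hF : Function.Injective (fderiv ℝ F u)) (hR : IsInducedCurvature B F 𝒮 u R)
    (halg : IsAlgebraicCurvature R) (hN : IsDualFrame B F 𝒮 u ξ N) {x : E} {J : Module.End ℝ E}
    (hJ : IsPseudoJacobi (associatedMetric B F u N) R x J) : IsNilpotent J := by
  refine ⟨2, hJ.sq_eq_zero (hN.nondegenerate_associatedMetric hB hF) halg
    (fun v => hN.mem_of_associatedMetric_eq_zero hB (hK.orthogonal_le u hu))
    fun x y w k hk => ?_⟩
  rw [hR, curvatureAt_eq_zero_of_eventually_fderiv_eq (hK.eventually_fderiv_eq u hu k hk),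
    map_zero, LinearMap.zero_apply]

theorem existsUnique_pseudoJacobi_and_charpoly [FiniteDimensional ℝ E]
    (hK : IsParallelCoisotropic B F U K) (hB : B.IsSymm) (hF : IsSmoothEmbedding U F)
    (h𝒮 : IsAdmissible B F U r 𝒮) (hu : u ∈ U) (x : E) (hR : IsInducedCurvature B F 𝒮 u R)
    (hN : IsDualFrame B F 𝒮 u ξ N) :
    (∃! J, IsPseudoJacobi (associatedMetric B F u N) R x J) ∧
      ∀ J, IsPseudoJacobi (associatedMetric B F u N) R x J →
        IsNilpotent J ∧ J.charpoly = Polynomial.X ^ Module.finrank ℝ E := by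
  have hinj := hF.immersion u hu
  obtain ⟨R', hR', halg⟩ := h𝒮.algebraic u hu
  obtain rfl := hR.unique hR'
  refine ⟨existsUnique_isPseudoJacobi (hN.nondegenerate_associatedMetric hB hinj) R x,
    fun J hJ => ?_⟩
  have hnil := hK.isNilpotent_pseudoJacobi hB hu hinj hR halg hN hJ
  exact ⟨hnil, hnil.charpoly_eq_X_pow_finrank⟩

theorem isGloballyOsserman [FiniteDimensional ℝ E] (hK : IsParallelCoisotropic B F U K)
    (hB : B.IsSymm) (hF : IsSmoothEmbedding U F) (r : ℕ) : IsGloballyOsserman B F U r := by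
  refine fun 𝒮 h𝒮 _ _ => ⟨Polynomial.X ^ Module.finrank ℝ E, fun u hu x _ R hR ξ N hN => ?_⟩
  have hJ := hK.existsUnique_pseudoJacobi_and_charpoly hB hF h𝒮 hu x hR hN
  exact ⟨hJ.1.exists, fun J hJx => (hJ.2 J hJx).2⟩

end IsParallelCoisotropic

/-- A frame of null tangent fields `ξ i` together with constant orthonormal ambient vectors `w i`
that are dual to it. It yields a lightlike transversal bundle, spanned by the
`lightlikeTransversal F ξ w i`. -/
structure IsNullRigging (B : LinearMap.BilinForm ℝ V) (F : E → V) (U : Set E) {r : ℕ}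
    (ξ : Fin r → E → E) (w : Fin r → V) : Prop where
  contDiffOn : ∀ i, ContDiffOn ℝ ∞ (ξ i) U
  mem_ker : ∀ u ∈ U, ∀ i, ξ i u ∈ LinearMap.ker (inducedMetric B F u)
  pairing : ∀ u ∈ U, ∀ i j, B (fderiv ℝ F u (ξ i u)) (w j) = if i = j then 1 else 0
  orthonormal : ∀ i j, B (w i) (w j) = if i = j then 1 else 0

/-- The null vectors `w i - ξ i / 2`, which are dual to the `ξ i`. -/
noncomputable def lightlikeTransversal (F : E → V) {r : ℕ} (ξ : Fin r → E → E) (w : Fin r → V)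
    (i : Fin r) (u : E) : V :=
  w i - (1 / 2 : ℝ) • fderiv ℝ F u (ξ i u)

namespace IsNullRigging

variable {r : ℕ} {ξ : Fin r → E → E} {w : Fin r → V} {𝒮 : Screens E V}

theorem apply_fderiv_null_eq_zero (h : IsNullRigging B F U ξ w) (hu : u ∈ U) (i : Fin r)
    (v : E) : B (fderiv ℝ F u (ξ i u)) (fderiv ℝ F u v) = 0 :=
  LinearMap.congr_fun (h.mem_ker u hu i) v

theorem linearIndependent (h : IsNullRigging B F U ξ w) (hu : u ∈ U) :
    LinearIndependent ℝ fun i => fderiv ℝ F u (ξ i u) :=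
  linearIndependent_of_dual_pairing (h.pairing u hu)

theorem span_eq_radSpace [FiniteDimensional ℝ V] (h : IsNullRigging B F U ξ w) (hB : B.IsSymm)
    (hnd : B.Nondegenerate) (hu : u ∈ U) (hF : Function.Injective (fderiv ℝ F u))
    (hcodim : Module.finrank ℝ V = Module.finrank ℝ E + r) :
    Submodule.span ℝ (Set.range fun i => fderiv ℝ F u (ξ i u)) = radSpace B F u := by
  refine Submodule.eq_of_le_of_finrank_le ?_ ?_
  · rw [Submodule.span_le, radSpace_eq_map_ker hB]
    rintro _ ⟨i, rfl⟩
    exact ⟨ξ i u, h.mem_ker u hu i, rfl⟩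
  · rw [finrank_span_eq_card (h.linearIndependent hu), Fintype.card_fin,
      ← finrank_perp_tangentSpace hnd hF hcodim]
    exact Submodule.finrank_mono inf_le_right

theorem isCoisotropic [FiniteDimensional ℝ V] (h : IsNullRigging B F U ξ w) (hB : B.IsSymm)
    (hnd : B.Nondegenerate) (hF : IsSmoothEmbedding U F) (hr : 0 < r)
    (hcodim : Module.finrank ℝ V = Module.finrank ℝ E + r) : IsCoisotropic B F U r := by
  have hspan (u : E) (hu : u ∈ U) := h.span_eq_radSpace hB hnd hu (hF.immersion u hu) hcodim
  refine ⟨⟨hF, hr, ?_, fun u hu => ?_⟩, hcodim⟩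
  · exact isSmoothSubbundle_of_frame hF.isOpen
      (fun i => hF.contDiffOn_fderiv_apply (h.contDiffOn i)) (fun u => h.linearIndependent) hspan
  · rw [← hspan u hu, finrank_span_eq_card (h.linearIndependent hu), Fintype.card_fin]

theorem apply_fderiv_lightlikeTransversal (h : IsNullRigging B F U ξ w) (hB : B.IsSymm)
    (hu : u ∈ U) (v : E) (i : Fin r) :
    B (fderiv ℝ F u v) (lightlikeTransversal F ξ w i u) = B (fderiv ℝ F u v) (w i) := by
  rw [lightlikeTransversal, map_sub, map_smul, hB.eq _ (fderiv ℝ F u (ξ i u)),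
    h.apply_fderiv_null_eq_zero hu, smul_zero, sub_zero]

theorem isDualFrame (h : IsNullRigging B F U ξ w) (hB : B.IsSymm) (hu : u ∈ U)
    (hspan : Submodule.span ℝ (Set.range fun i => fderiv ℝ F u (ξ i u)) = radSpace B F u)
    (hltr : 𝒮.ltr u = Submodule.span ℝ (Set.range fun i => lightlikeTransversal F ξ w i u)) :
    IsDualFrame B F 𝒮 u (fun i => fderiv ℝ F u (ξ i u))
      (fun i => lightlikeTransversal F ξ w i u) where
  ξ_indep := h.linearIndependent hu
  ξ_span := hspan
  N_span := hltr.symm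
  pairing i j := (h.apply_fderiv_lightlikeTransversal hB hu _ j).trans (h.pairing u hu i j)
  N_null i j := by
    rw [lightlikeTransversal, map_sub, map_smul, LinearMap.sub_apply, LinearMap.smul_apply,
      h.apply_fderiv_lightlikeTransversal hB hu, h.pairing u hu, lightlikeTransversal, map_sub,
      map_smul, h.orthonormal, hB.eq (w i), h.pairing u hu]
    simp only [eq_comm (a := j), smul_eq_mul]
    ring

theorem bijective_coprod [FiniteDimensional ℝ V] [FiniteDimensional ℝ E]
    (h : IsNullRigging B F U ξ w) (hB : B.IsSymm) (hu : u ∈ U)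
    (hF : Function.Injective (fderiv ℝ F u))
    (hcodim : Module.finrank ℝ V = Module.finrank ℝ E + r)
    (htr : 𝒮.tr u = Submodule.span ℝ (Set.range fun i => lightlikeTransversal F ξ w i u)) :
    Function.Bijective
      (LinearMap.coprod (fderiv ℝ F u).toLinearMap (𝒮.tr u).subtype) := by
  have hpair (i j : Fin r) : B (lightlikeTransversal F ξ w i u) (fderiv ℝ F u (ξ j u)) =
      if i = j then 1 else 0 := by
    rw [hB.eq, h.apply_fderiv_lightlikeTransversal hB hu, h.pairing u hu]
    simp only [eq_comm]
  have hinj : Function.Injective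
      (LinearMap.coprod (fderiv ℝ F u).toLinearMap (𝒮.tr u).subtype) := by
    rw [injective_iff_map_eq_zero]
    rintro ⟨v, t, ht⟩ (hvt : fderiv ℝ F u v + t = 0)
    have ht0 : t = 0 := by
      refine eq_zero_of_mem_span_of_dual_pairing hpair (htr ▸ ht) fun j => ?_
      rw [eq_neg_of_add_eq_zero_right hvt, map_neg, LinearMap.neg_apply, hB.eq,
        h.apply_fderiv_null_eq_zero hu, neg_zero]
    have hv0 : v = 0 := hF (by simpa [ht0] using hvt)
    simp [ht0, hv0]
  have hdim : Module.finrank ℝ (E × 𝒮.tr u) = Module.finrank ℝ V := by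
    rw [Module.finrank_prod, htr, finrank_span_eq_card (linearIndependent_of_dual_pairing hpair),
      Fintype.card_fin, hcodim]
  exact ⟨hinj, (LinearMap.injective_iff_surjective_of_finrank_eq_finrank hdim).mp hinj⟩

theorem contDiffOn_lightlikeTransversal (h : IsNullRigging B F U ξ w) (hF : IsSmoothEmbedding U F)
    (i : Fin r) : ContDiffOn ℝ ∞ (lightlikeTransversal F ξ w i) U :=
  contDiffOn_const.sub (contDiffOn_const.smul (hF.contDiffOn_fderiv_apply (h.contDiffOn i)))

theorem disjoint_radSpace (h : IsNullRigging B F U ξ w) (hu : u ∈ U)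
    (hspan : Submodule.span ℝ (Set.range fun i => fderiv ℝ F u (ξ i u)) = radSpace B F u)
    {S : Submodule ℝ V} (hS : ∀ v ∈ S, ∀ j, B v (w j) = 0) : Disjoint (radSpace B F u) S :=
  Submodule.disjoint_def.mpr fun v hv hvS =>
    eq_zero_of_mem_span_of_dual_pairing (h.pairing u hu) (hspan ▸ hv) (hS v hvS)

theorem radSpace_sup_eq_tangentSpace [FiniteDimensional ℝ V]
    (h : IsNullRigging B F U ξ w) (hu : u ∈ U) (hF : Function.Injective (fderiv ℝ F u))
    (hspan : Submodule.span ℝ (Set.range fun i => fderiv ℝ F u (ξ i u)) = radSpace B F u)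
    {S : Submodule ℝ V} (hS : ∀ v ∈ S, ∀ j, B v (w j) = 0) (hST : S ≤ tangentSpace F u)
    (hdim : Module.finrank ℝ S + r = Module.finrank ℝ E) :
    radSpace B F u ⊔ S = tangentSpace F u := by
  refine Submodule.eq_of_le_of_finrank_le (sup_le inf_le_left hST) ?_
  have hrad : Module.finrank ℝ (radSpace B F u) = r := by
    rw [← hspan, finrank_span_eq_card (h.linearIndependent hu), Fintype.card_fin]
  have hsup := Submodule.finrank_sup_add_finrank_inf_eq (radSpace B F u) S
  rw [(h.disjoint_radSpace hu hspan hS).eq_bot, finrank_bot, hrad] at hsup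
  rw [tangentSpace, LinearMap.finrank_range_of_inj hF]
  lia

theorem radSpace_eq_perp_tangentSpace [FiniteDimensional ℝ V] (h : IsNullRigging B F U ξ w)
    (hnd : B.Nondegenerate) (hu : u ∈ U) (hF : Function.Injective (fderiv ℝ F u))
    (hspan : Submodule.span ℝ (Set.range fun i => fderiv ℝ F u (ξ i u)) = radSpace B F u)
    (hcodim : Module.finrank ℝ V = Module.finrank ℝ E + r) :
    radSpace B F u = perp B (tangentSpace F u) := by
  refine Submodule.eq_of_le_of_finrank_eq inf_le_right ?_
  rw [finrank_perp_tangentSpace hnd hF hcodim, ← hspan,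
    finrank_span_eq_card (h.linearIndependent hu), Fintype.card_fin]

theorem span_lightlikeTransversal_le_perp (h : IsNullRigging B F U ξ w) (hB : B.IsSymm)
    (hu : u ∈ U) {S : Submodule ℝ V} (hS : ∀ v ∈ S, ∀ j, B v (w j) = 0)
    (hST : S ≤ tangentSpace F u) :
    Submodule.span ℝ (Set.range fun i => lightlikeTransversal F ξ w i u) ≤ perp B S := by
  rw [Submodule.span_le]
  rintro _ ⟨j, rfl⟩ v hv
  obtain ⟨a, rfl⟩ := hST hv
  exact (h.apply_fderiv_lightlikeTransversal hB hu a j).trans (hS _ hv j)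

theorem isScreens [FiniteDimensional ℝ V] {ι : Type*} [Fintype ι]
    {s : ι → E → E} (h : IsNullRigging B F U ξ w) (hB : B.IsSymm) (hnd : B.Nondegenerate)
    (hF : IsSmoothEmbedding U F) (hcodim : Module.finrank ℝ V = Module.finrank ℝ E + r)
    (hs : ∀ i, ContDiffOn ℝ ∞ (s i) U) (hli : ∀ u ∈ U, LinearIndependent ℝ fun i => s i u)
    (hcard : Fintype.card ι + r = Module.finrank ℝ E)
    (hsw : ∀ u ∈ U, ∀ i j, B (fderiv ℝ F u (s i u)) (w j) = 0)
    (hscreen : ∀ u ∈ U, 𝒮.screen u = Submodule.span ℝ (Set.range fun i => fderiv ℝ F u (s i u)))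
    (hscreenPerp : ∀ u ∈ U, 𝒮.screenPerp u = ⊥)
    (hltr : ∀ u ∈ U, 𝒮.ltr u =
      Submodule.span ℝ (Set.range fun i => lightlikeTransversal F ξ w i u)) :
    IsScreens B F U r 𝒮 := by
  have hspan (u : E) (hu : u ∈ U) := h.span_eq_radSpace hB hnd hu (hF.immersion u hu) hcodim
  have hliF (u : E) (hu : u ∈ U) : LinearIndependent ℝ fun i => fderiv ℝ F u (s i u) :=
    (hli u hu).map' _ (LinearMap.ker_eq_bot.mpr (hF.immersion u hu))
  have hSw (u : E) (hu : u ∈ U) (v : V) (hv : v ∈ 𝒮.screen u) (j : Fin r) : B v (w j) = 0 := by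
    have hle : 𝒮.screen u ≤ LinearMap.ker (B.flip (w j)) :=
      hscreen u hu ▸ Submodule.span_le.mpr (Set.range_subset_iff.mpr fun i => hsw u hu i j)
    exact hle hv
  have hST (u : E) (hu : u ∈ U) : 𝒮.screen u ≤ tangentSpace F u :=
    hscreen u hu ▸ Submodule.span_le.mpr (Set.range_subset_iff.mpr fun i => ⟨s i u, rfl⟩)
  refine
    { screen_smooth := isSmoothSubbundle_of_frame hF.isOpen
        (fun i => hF.contDiffOn_fderiv_apply (hs i)) hliF fun u hu => (hscreen u hu).symm
      screen_disjoint := fun u hu => h.disjoint_radSpace hu (hspan u hu) (hSw u hu)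
      screen_sup := fun u hu => h.radSpace_sup_eq_tangentSpace hu (hF.immersion u hu) (hspan u hu)
        (hSw u hu) (hST u hu) ?_
      screenPerp_smooth := isSmoothSubbundle_of_frame (ι := Fin 0) hF.isOpen (s := Fin.elim0)
        (fun i => i.elim0) (fun _ _ => linearIndependent_empty_type) fun u hu => by
          simp [hscreenPerp u hu]
      screenPerp_disjoint := fun u hu => hscreenPerp u hu ▸ disjoint_bot_right
      screenPerp_sup := fun u hu => ?_
      ltr_orthogonal := fun u hu => le_inf
        (hltr u hu ▸ h.span_lightlikeTransversal_le_perp hB hu (hSw u hu) (hST u hu)) ?_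
      ltr_frame := fun u₀ hu₀ => ⟨U, hF.isOpen, hu₀, subset_rfl, _, _,
        fun i => hF.contDiffOn_fderiv_apply (h.contDiffOn i),
        h.contDiffOn_lightlikeTransversal hF,
        fun u hu => h.isDualFrame hB hu (hspan u hu) (hltr u hu)⟩ }
  · rw [hscreen u hu, finrank_span_eq_card (hliF u hu), hcard]
  · rw [hscreenPerp u hu, sup_bot_eq,
      h.radSpace_eq_perp_tangentSpace hnd hu (hF.immersion u hu) (hspan u hu) hcodim]
  · rw [hscreenPerp u hu, perp, LinearMap.BilinForm.orthogonal_bot]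
    exact le_top

end IsNullRigging

/-- The radical field `½ ∑ i, B (d²F (y, z)) (w i) • ξ i`. When `d²F` takes values in the span of
the `w i`, it is the covariant derivative `∇_y z` of constant fields for the connection given by the
transversal bundle spanned by the `lightlikeTransversal F ξ w i`. -/
noncomputable def christoffel (B : LinearMap.BilinForm ℝ V) (F : E → V) {r : ℕ}
    (ξ : Fin r → E → E) (w : Fin r → V) (y z u : E) : E :=
  ∑ i, ((1 / 2 : ℝ) * B (fderiv ℝ (fderiv ℝ F) u y z) (w i)) • ξ i u

namespace IsNullRigging

variable {r : ℕ} {ξ : Fin r → E → E} {w : Fin r → V} {𝒮 : Screens E V}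

theorem christoffel_mem_ker (h : IsNullRigging B F U ξ w) (hu : u ∈ U) (y z : E) :
    christoffel B F ξ w y z u ∈ LinearMap.ker (inducedMetric B F u) :=
  Submodule.sum_mem _ fun i _ => Submodule.smul_mem _ _ (h.mem_ker u hu i)

theorem differentiableAt_christoffel [FiniteDimensional ℝ V] (h : IsNullRigging B F U ξ w)
    (hF : IsSmoothEmbedding U F) (hu : u ∈ U) (y z : E) :
    DifferentiableAt ℝ (christoffel B F ξ w y z) u := by
  have hFn := (hF.smooth.fderiv_of_isOpen (m := ∞) hF.isOpen (by simp)).fderiv_of_isOpen (m := ∞)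
    hF.isOpen (by simp)
  have hcoeff (i : Fin r) :
      ContDiffOn ℝ ∞ (fun q => B (fderiv ℝ (fderiv ℝ F) q y z) (w i)) U :=
    (LinearMap.toContinuousLinearMap (B.flip (w i))).contDiff.comp_contDiffOn
      ((hFn.clm_apply contDiffOn_const).clm_apply contDiffOn_const)
  have hsmooth : ContDiffOn ℝ ∞ (christoffel B F ξ w y z) U :=
    ContDiffOn.sum fun i _ => (contDiffOn_const.mul (hcoeff i)).smul (h.contDiffOn i)
  exact (hsmooth.contDiffAt (hF.isOpen.mem_nhds hu)).differentiableAt (by simp)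

theorem fderiv_fderiv_eq_add (h : IsNullRigging B F U ξ w) {y z : E}
    (hD : fderiv ℝ (fderiv ℝ F) u y z ∈ Submodule.span ℝ (Set.range w)) :
    fderiv ℝ (fderiv ℝ F) u y z = fderiv ℝ F u (christoffel B F ξ w y z u) +
      ∑ i, B (fderiv ℝ (fderiv ℝ F) u y z) (w i) • lightlikeTransversal F ξ w i u := by
  conv_lhs => rw [eq_sum_of_mem_span_of_dual_pairing h.orthonormal hD]
  simp only [christoffel, lightlikeTransversal, map_sum, map_smul, ← Finset.sum_add_distrib]
  exact Finset.sum_congr rfl fun i _ => by module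

theorem connection_const_eq_christoffel (h : IsNullRigging B F U ξ w) {y z : E}
    (hF : DifferentiableAt ℝ (fderiv ℝ F) u)
    (hb : Function.Bijective (LinearMap.coprod (fderiv ℝ F u).toLinearMap (𝒮.tr u).subtype))
    (htr : 𝒮.tr u = Submodule.span ℝ (Set.range fun i => lightlikeTransversal F ξ w i u))
    (hD : fderiv ℝ (fderiv ℝ F) u y z ∈ Submodule.span ℝ (Set.range w)) :
    connection F 𝒮 (fun _ => y) (fun _ => z) u = christoffel B F ξ w y z u := by
  rw [connection, fderiv_fderiv_apply hF, h.fderiv_fderiv_eq_add hD, tangentialPart_eq hb]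
  rw [htr]
  exact Submodule.sum_mem _ fun i _ => Submodule.smul_mem _ _ (Submodule.subset_span ⟨i, rfl⟩)

theorem apply_fderiv_christoffel (h : IsNullRigging B F U ξ w) (hu : u ∈ U) (y z : E) {v : V}
    (hv : v ∈ Submodule.span ℝ (Set.range w)) :
    B (fderiv ℝ F u (christoffel B F ξ w y z u)) v =
      (1 / 2 : ℝ) * B (fderiv ℝ (fderiv ℝ F) u y z) v := by
  obtain ⟨c, rfl⟩ := (Submodule.mem_span_range_iff_exists_fun ℝ).mp hv
  simp [christoffel, LinearMap.sum_apply, h.pairing u hu, Finset.mul_sum, mul_left_comm]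

end IsNullRigging

/-- A null rigging such that `d²F` takes values in the span of the `w i` and the `ξ i` lie
in the nullity of `d²F`: the induced connection then differs from the flat connection of the
chart by radical terms. -/
structure IsAdaptedNullRigging (B : LinearMap.BilinForm ℝ V) (F : E → V) (U : Set E) {r : ℕ}
    (ξ : Fin r → E → E) (w : Fin r → V) : Prop extends IsNullRigging B F U ξ w where
  fderiv_fderiv_mem_span : ∀ u ∈ U, ∀ x y,
    fderiv ℝ (fderiv ℝ F) u x y ∈ Submodule.span ℝ (Set.range w)
  fderiv_fderiv_eq_zero : ∀ u ∈ U, ∀ x i, fderiv ℝ (fderiv ℝ F) u x (ξ i u) = 0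

namespace IsAdaptedNullRigging

variable {r : ℕ} {ξ : Fin r → E → E} {w : Fin r → V} {𝒮 : Screens E V}

theorem inducedMetric_connection_connection [FiniteDimensional ℝ V]
    (h : IsAdaptedNullRigging B F U ξ w) (hF : IsSmoothEmbedding U F)
    (hb : ∀ u ∈ U, Function.Bijective
      (LinearMap.coprod (fderiv ℝ F u).toLinearMap (𝒮.tr u).subtype))
    (htr : ∀ u ∈ U,
      𝒮.tr u = Submodule.span ℝ (Set.range fun i => lightlikeTransversal F ξ w i u))
    (hu : u ∈ U) (x y z v : E) :
    inducedMetric B F u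
        (connection F 𝒮 (fun _ => x) (connection F 𝒮 (fun _ => y) fun _ => z) u) v =
      -((1 / 2 : ℝ) * B (fderiv ℝ (fderiv ℝ F) u y z) (fderiv ℝ (fderiv ℝ F) u x v)) := by
  have hFu := hF.differentiableAt_fderiv hu
  have hΓ := h.differentiableAt_christoffel hF hu y z
  have hnear : ∀ᶠ q in nhds u, q ∈ U := hF.isOpen.mem_nhds hu
  have hconn : connection F 𝒮 (fun _ => y) (fun _ => z) =ᶠ[nhds u] christoffel B F ξ w y z :=
    hnear.mono fun q hq => h.connection_const_eq_christoffel (hF.differentiableAt_fderiv hq)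
      (hb q hq) (htr q hq) (h.fderiv_fderiv_mem_span q hq y z)
  have hDΓ : fderiv ℝ (fderiv ℝ F) u x (christoffel B F ξ w y z u) = 0 := by
    simp [christoffel, h.fderiv_fderiv_eq_zero u hu]
  rw [connection_congr hconn, connection_eq_fderiv (hb u hu) hFu hΓ hDΓ,
    inducedMetric_fderiv_of_mem_ker hFu hΓ (hnear.mono fun q hq => h.christoffel_mem_ker hq y z)
      hDΓ, h.apply_fderiv_christoffel hu y z (h.fderiv_fderiv_mem_span u hu x v)]

theorem isInducedCurvature_gaussTensor [FiniteDimensional ℝ V]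
    (h : IsAdaptedNullRigging B F U ξ w) (hF : IsSmoothEmbedding U F)
    (hb : ∀ u ∈ U, Function.Bijective
      (LinearMap.coprod (fderiv ℝ F u).toLinearMap (𝒮.tr u).subtype))
    (htr : ∀ u ∈ U,
      𝒮.tr u = Submodule.span ℝ (Set.range fun i => lightlikeTransversal F ξ w i u))
    (hu : u ∈ U) :
    IsInducedCurvature B F 𝒮 u
      ((1 / 2 : ℝ) • gaussTensor B (fderiv ℝ (fderiv ℝ F) u).toLinearMap₁₂) := by
  intro x y z v
  have hconn := h.inducedMetric_connection_connection hF hb htr hu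
  rw [curvatureAt_eq_sub, map_sub, LinearMap.sub_apply, hconn, hconn]
  simp only [LinearMap.smul_apply, gaussTensor_apply, smul_eq_mul,
    ContinuousLinearMap.toLinearMap₁₂_apply, LinearMap.comp_apply,
    ContinuousLinearMap.coeLMₛₗ_apply, ContinuousLinearMap.coe_coe]
  ring

theorem isAdmissible [FiniteDimensional ℝ E] [FiniteDimensional ℝ V]
    (h : IsAdaptedNullRigging B F U ξ w) (hB : B.IsSymm) (hF : IsSmoothEmbedding U F)
    (hcodim : Module.finrank ℝ V = Module.finrank ℝ E + r)
    (htr : ∀ u ∈ U,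
      𝒮.tr u = Submodule.span ℝ (Set.range fun i => lightlikeTransversal F ξ w i u))
    (h𝒮 : IsScreens B F U r 𝒮) : IsAdmissible B F U r 𝒮 where
  isScreens := h𝒮
  algebraic u hu := by
    have hb (q : E) (hq : q ∈ U) := h.bijective_coprod hB hq (hF.immersion q hq) hcodim (htr q hq)
    have hsymm : IsSymmSndFDerivAt ℝ F u :=
      (hF.smooth.contDiffAt (hF.isOpen.mem_nhds hu)).isSymmSndFDerivAt
        (by simpa using WithTop.coe_le_coe.mpr (le_top (a := (2 : ℕ∞))))
    exact ⟨_, h.isInducedCurvature_gaussTensor hF hb htr hu,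
      (isAlgebraicCurvature_gaussTensor hB hsymm.eq).smul _⟩

end IsAdaptedNullRigging

end Submanifold

section AmbientMetric

variable {p : ℕ}

theorem ambientMetric_apply (a b : Ambient p) :
    ambientMetric p a b =
      ∑ i : Fin p, (a.1 i.succ * b.2.1 i.succ + a.2.1 i.succ * b.1 i.succ)
        + (a.1 0 * b.2.2.1 + a.2.2.1 * b.1 0) + (a.2.1 0 * b.2.2.2 + a.2.2.2 * b.2.1 0)
        + a.2.2.1 * b.2.2.1 + a.2.2.2 * b.2.2.2 := by
  simp [ambientMetric, symProd, LinearMap.sum_apply, cu, cv, cw₁, cw₂,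
    LinearMap.BilinForm.linMulLin_apply]

theorem isSymm_ambientMetric : (ambientMetric p).IsSymm where
  eq a b := by
    have hsum : ∑ i : Fin p, (a.1 i.succ * b.2.1 i.succ + a.2.1 i.succ * b.1 i.succ) =
        ∑ i : Fin p, (b.1 i.succ * a.2.1 i.succ + b.2.1 i.succ * a.1 i.succ) :=
      Finset.sum_congr rfl fun i _ => by ring
    rw [ambientMetric_apply, ambientMetric_apply, hsum]
    ring

theorem nondegenerate_ambientMetric : (ambientMetric p).Nondegenerate := by
  refine isSymm_ambientMetric.isRefl.nondegenerate_iff_separatingLeft.mpr fun a ha => ?_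
  have hu (i : Fin p) : a.1 i.succ = 0 := by
    simpa [ambientMetric_apply, Pi.single_apply] using ha (0, Pi.single i.succ 1, 0, 0)
  have hv (i : Fin p) : a.2.1 i.succ = 0 := by
    simpa [ambientMetric_apply, Pi.single_apply] using ha (Pi.single i.succ 1, 0, 0, 0)
  have hw₁ : a.2.2.1 = 0 := by
    simpa [ambientMetric_apply] using ha (Pi.single 0 1, 0, 0, 0)
  have hw₂ : a.2.2.2 = 0 := by
    simpa [ambientMetric_apply] using ha (0, Pi.single 0 1, 0, 0)
  have hu₀ : a.1 0 = 0 := by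
    simpa [ambientMetric_apply, hw₁] using ha (0, 0, 1, 0)
  have hv₀ : a.2.1 0 = 0 := by
    simpa [ambientMetric_apply, hw₂] using ha (0, 0, 0, 1)
  exact Prod.ext (funext (Fin.cases hu₀ hu)) (Prod.ext (funext (Fin.cases hv₀ hv))
    (Prod.ext hw₁ hw₂))

/-- The anti-isometry of the ambient metric that changes the sign of the `v_i` for `i ≥ 1`. On the
planes spanned by `u_0, w_1` and by `v_0, w_2`, where the form is `2 s t + t ^ 2`, it is
`(s, t) ↦ (s + t, -t)`. -/
noncomputable def ambientAntiIsometry (p : ℕ) : Ambient p ≃ₗ[ℝ] Ambient p :=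
  .ofInvolutive
    ((LinearMap.pi (Fin.cons (cu 0 + cw₁) fun i => cu i.succ)).prod
      ((LinearMap.pi (Fin.cons (cv 0 + cw₂) fun i => -cv i.succ)).prod ((-cw₁).prod (-cw₂))))
    fun a => by
      refine Prod.ext (funext (Fin.cases ?_ fun i => ?_))
        (Prod.ext (funext (Fin.cases ?_ fun i => ?_)) ?_) <;> simp [cu, cv, cw₁, cw₂]

theorem ambientAntiIsometry_apply (a : Ambient p) :
    ambientAntiIsometry p a = (Fin.cons (a.1 0 + a.2.2.1) (Fin.tail a.1),
      Fin.cons (a.2.1 0 + a.2.2.2) (-Fin.tail a.2.1), -a.2.2.1, -a.2.2.2) :=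
  Prod.ext (funext (Fin.cases rfl fun _ => rfl))
    (Prod.ext (funext (Fin.cases rfl fun _ => rfl)) rfl)

theorem ambientMetric_antiIsometry (a : Ambient p) :
    (ambientMetric p).toQuadraticMap (ambientAntiIsometry p a) =
      -(ambientMetric p).toQuadraticMap a := by
  simp only [LinearMap.BilinMap.toQuadraticMap_apply, ambientMetric_apply,
    ambientAntiIsometry_apply, Fin.cons_zero, Fin.cons_succ, Fin.tail, Pi.neg_apply, mul_neg,
    neg_mul, ← neg_add, Finset.sum_neg_distrib]
  ring

theorem finrank_ambient (p : ℕ) : Module.finrank ℝ (Ambient p) = 2 * p + 4 := by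
  simp only [Module.finrank_prod, Module.finrank_fin_fun, Module.finrank_self]
  ring

theorem isSemiEuclidean_ambientMetric (p : ℕ) :
    IsSemiEuclidean (ambientMetric p) (p + 2) (p + 2) :=
  isSemiEuclidean_of_antiIsometry isSymm_ambientMetric nondegenerate_ambientMetric
    (ambientAntiIsometry p) ambientMetric_antiIsometry (by rw [finrank_ambient]; ring)

end AmbientMetric

section Embedding

variable {p : ℕ} {O : Set (Fin p → ℝ)} {f h : (Fin p → ℝ) → ℝ}

/-- The continuous linear map that sends a coordinate vector to its components
`(x_1, …, x_p)`. -/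
noncomputable def tailL (p : ℕ) : Coord p →L[ℝ] (Fin p → ℝ) :=
  ContinuousLinearMap.pi fun i =>
    ContinuousLinearMap.proj i.succ ∘L
      ContinuousLinearMap.fst ℝ (Fin (p + 1) → ℝ) (Fin (p + 1) → ℝ)

theorem tailL_apply (q : Coord p) : tailL p q = Fin.tail q.1 :=
  rfl

theorem isOpen_domain (hO : IsOpen O) : IsOpen (domain O) :=
  hO.preimage (tailL p).continuous

theorem hasFDerivAt_comp_tail {G : Type*} [NormedAddCommGroup G] [NormedSpace ℝ G]
    {φ : (Fin p → ℝ) → G} {q : Coord p} (hφ : DifferentiableAt ℝ φ (Fin.tail q.1)) :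
    HasFDerivAt (fun q : Coord p => φ (Fin.tail q.1))
      (fderiv ℝ φ (Fin.tail q.1) ∘L tailL p) q :=
  HasFDerivAt.comp (f := tailL p) q hφ.hasFDerivAt (tailL p).hasFDerivAt

theorem contDiffOn_comp_tail {G : Type*} [NormedAddCommGroup G] [NormedSpace ℝ G]
    {φ : (Fin p → ℝ) → G} (hφ : ContDiffOn ℝ ∞ φ O) :
    ContDiffOn ℝ ∞ (fun q : Coord p => φ (Fin.tail q.1)) (domain O) :=
  hφ.comp (tailL p).contDiff.contDiffOn fun _ hq => hq

theorem fderiv_embFH {q : Coord p} (hf : DifferentiableAt ℝ f (Fin.tail q.1))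
    (hh : DifferentiableAt ℝ h (Fin.tail q.1)) (v : Coord p) :
    fderiv ℝ (embFH f h) q v = (v.1, v.2, fderiv ℝ f (Fin.tail q.1) (Fin.tail v.1),
      fderiv ℝ h (Fin.tail q.1) (Fin.tail v.1)) := by
  have hembFH : HasFDerivAt (embFH f h) _ q := hasFDerivAt_fst.prodMk
    (hasFDerivAt_snd.prodMk ((hasFDerivAt_comp_tail hf).prodMk (hasFDerivAt_comp_tail hh)))
  rw [hembFH.fderiv]
  rfl

theorem fderiv_eq_sum_pd (f : (Fin p → ℝ) → ℝ) (a v : Fin p → ℝ) :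
    fderiv ℝ f a v = ∑ i, pd f i a * v i := by
  conv_lhs => rw [pi_eq_sum_univ' v, map_sum]
  exact Finset.sum_congr rfl fun i _ => by rw [map_smul, smul_eq_mul, mul_comm, pd]

theorem metricFH_apply (f h : (Fin p → ℝ) → ℝ) (q v w : Coord p) :
    metricFH f h q v w =
      ∑ i : Fin p, (v.1 i.succ * w.2 i.succ + v.2 i.succ * w.1 i.succ)
      + (v.1 0 * fderiv ℝ f (Fin.tail q.1) (Fin.tail w.1)
        + fderiv ℝ f (Fin.tail q.1) (Fin.tail v.1) * w.1 0)
      + (v.2 0 * fderiv ℝ h (Fin.tail q.1) (Fin.tail w.1)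
        + fderiv ℝ h (Fin.tail q.1) (Fin.tail v.1) * w.2 0)
      + fderiv ℝ f (Fin.tail q.1) (Fin.tail v.1) * fderiv ℝ f (Fin.tail q.1) (Fin.tail w.1)
      + fderiv ℝ h (Fin.tail q.1) (Fin.tail v.1) * fderiv ℝ h (Fin.tail q.1) (Fin.tail w.1) := by
  simp only [fderiv_eq_sum_pd, metricFH, symProd, LinearMap.add_apply, LinearMap.sum_apply,
    LinearMap.smul_apply, LinearMap.BilinForm.linMulLin_apply, smul_eq_mul, dx, dy,
    LinearMap.coe_comp, Function.comp_apply, LinearMap.fst_apply, LinearMap.snd_apply,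
    LinearMap.proj_apply, Fin.tail]
  have hquadratic (a b : Fin p → ℝ) :
      ∑ i, ∑ j, (a i * a j + b i * b j) * (v.1 i.succ * w.1 j.succ) =
        (∑ i, a i * v.1 i.succ) * (∑ i, a i * w.1 i.succ)
          + (∑ i, b i * v.1 i.succ) * ∑ i, b i * w.1 i.succ := by
    simp only [Finset.sum_mul_sum, ← Finset.sum_add_distrib]
    exact Finset.sum_congr rfl fun i _ => Finset.sum_congr rfl fun j _ => by ring
  have hmixed (a b : Fin p → ℝ) :
      ∑ i, (a i * (v.1 0 * w.1 i.succ + v.1 i.succ * w.1 0)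
          + b i * (v.1 i.succ * w.2 0 + v.2 0 * w.1 i.succ)) =
        (v.1 0 * ∑ i, a i * w.1 i.succ) + (∑ i, a i * v.1 i.succ) * w.1 0
          + ((v.2 0 * ∑ i, b i * w.1 i.succ) + (∑ i, b i * v.1 i.succ) * w.2 0) := by
    simp only [Finset.mul_sum, Finset.sum_mul, ← Finset.sum_add_distrib]
    exact Finset.sum_congr rfl fun i _ => by ring
  rw [hquadratic (fun i => pd f i _) fun i => pd h i _,
    hmixed (fun i => pd f i _) fun i => pd h i _]
  ring

theorem inducedMetric_embFH {q : Coord p} (hf : DifferentiableAt ℝ f (Fin.tail q.1))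
    (hh : DifferentiableAt ℝ h (Fin.tail q.1)) :
    inducedMetric (ambientMetric p) (embFH f h) q = metricFH f h q := by
  refine LinearMap.ext₂ fun v w => ?_
  rw [inducedMetric_apply, fderiv_embFH hf hh, fderiv_embFH hf hh, ambientMetric_apply,
    metricFH_apply]

theorem differentiableAt_of_mem_domain (hO : IsOpen O) (hf : ContDiffOn ℝ ∞ f O) {q : Coord p}
    (hq : q ∈ domain O) : DifferentiableAt ℝ f (Fin.tail q.1) :=
  (hf.contDiffAt (hO.mem_nhds hq)).differentiableAt (by simp)

theorem contDiffOn_embFH (hf : ContDiffOn ℝ ∞ f O) (hh : ContDiffOn ℝ ∞ h O) :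
    ContDiffOn ℝ ∞ (embFH f h) (domain O) :=
  contDiff_fst.contDiffOn.prodMk (contDiff_snd.contDiffOn.prodMk
    ((contDiffOn_comp_tail hf).prodMk (contDiffOn_comp_tail hh)))

theorem isSmoothEmbedding_embFH (hO : IsOpen O) (hf : ContDiffOn ℝ ∞ f O)
    (hh : ContDiffOn ℝ ∞ h O) : IsSmoothEmbedding (domain O) (embFH f h) where
  isOpen := isOpen_domain hO
  smooth := contDiffOn_embFH hf hh
  immersion q hq v w hvw := by
    simp only [fderiv_embFH (differentiableAt_of_mem_domain hO hf hq)
      (differentiableAt_of_mem_domain hO hh hq), Prod.mk.injEq] at hvw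
    exact Prod.ext hvw.1 hvw.2.1
  embedding := by
    have hcoord : Topology.IsEmbedding
        ((fun a : Ambient p => ((a.1, a.2.1) : Coord p)) ∘ (domain O).domRestrict (embFH f h)) :=
      Topology.IsEmbedding.subtypeVal
    exact .of_comp
      (continuousOn_iff_continuous_domRestrict.mp (contDiffOn_embFH hf hh).continuousOn)
      (by fun_prop) hcoord

theorem fderiv_fderiv_embFH (hO : IsOpen O) (hf : ContDiffOn ℝ ∞ f O) (hh : ContDiffOn ℝ ∞ h O)
    {q : Coord p} (hq : q ∈ domain O) (x y : Coord p) :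
    fderiv ℝ (fderiv ℝ (embFH f h)) q x y =
      (0, 0, fderiv ℝ (fderiv ℝ f) (Fin.tail q.1) (Fin.tail x.1) (Fin.tail y.1),
        fderiv ℝ (fderiv ℝ h) (Fin.tail q.1) (Fin.tail x.1) (Fin.tail y.1)) := by
  have hnear : (fun q => fderiv ℝ (embFH f h) q y) =ᶠ[nhds q] fun q =>
      (y.1, y.2, fderiv ℝ f (Fin.tail q.1) (Fin.tail y.1),
        fderiv ℝ h (Fin.tail q.1) (Fin.tail y.1)) :=
    ((isOpen_domain hO).eventually_mem hq).mono fun q hq =>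
      fderiv_embFH (differentiableAt_of_mem_domain hO hf hq)
        (differentiableAt_of_mem_domain hO hh hq) y
  have hsnd {φ : (Fin p → ℝ) → ℝ} (hφ : ContDiffOn ℝ ∞ φ O) :
      HasFDerivAt (fun q : Coord p => fderiv ℝ φ (Fin.tail q.1) (Fin.tail y.1))
        (((fderiv ℝ (fderiv ℝ φ) (Fin.tail q.1)).flip (Fin.tail y.1)) ∘L tailL p) q := by
    have hDφ := differentiableAt_fderiv_of_contDiffOn hφ hO hq
    exact ((hasFDerivAt_comp_tail hDφ).clm_apply
      (hasFDerivAt_const (Fin.tail y.1) q)).congr_fderiv (ContinuousLinearMap.ext fun v => by simp)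
  have hembFH := (hasFDerivAt_const y.1 q).prodMk
    ((hasFDerivAt_const y.2 q).prodMk ((hsnd hf).prodMk (hsnd hh)))
  rw [← fderiv_fderiv_apply ((isSmoothEmbedding_embFH hO hf hh).differentiableAt_fderiv hq),
    hnear.fderiv_eq, hembFH.fderiv]
  rfl

end Embedding

section Rigging

variable {p : ℕ} {O : Set (Fin p → ℝ)} {f h : (Fin p → ℝ) → ℝ}

theorem contDiffOn_pd (hO : IsOpen O) (hf : ContDiffOn ℝ ∞ f O) (i : Fin p) :
    ContDiffOn ℝ ∞ (pd f i) O :=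
  (hf.fderiv_of_isOpen hO (by simp)).clm_apply contDiffOn_const

theorem contDiffOn_xi₁ (hO : IsOpen O) (hf : ContDiffOn ℝ ∞ f O) :
    ContDiffOn ℝ ∞ (xi₁ f) (domain O) :=
  contDiffOn_const.prodMk (contDiffOn_pi.mpr (Fin.cases contDiffOn_const fun i =>
    (contDiffOn_comp_tail (contDiffOn_pd hO hf i)).neg))

theorem contDiffOn_xi₂ (hO : IsOpen O) (hh : ContDiffOn ℝ ∞ h O) :
    ContDiffOn ℝ ∞ (xi₂ h) (domain O) :=
  contDiffOn_const.prodMk (contDiffOn_pi.mpr (Fin.cases contDiffOn_const fun i =>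
    (contDiffOn_comp_tail (contDiffOn_pd hO hh i)).neg))

theorem tail_single_zero (c : ℝ) : Fin.tail (Pi.single 0 c : Fin (p + 1) → ℝ) = 0 := by
  ext i
  simp [Fin.tail]

theorem metricFH_xi₁ (f h : (Fin p → ℝ) → ℝ) (q : Coord p) : metricFH f h q (xi₁ f q) = 0 := by
  refine LinearMap.ext fun v => ?_
  rw [metricFH_apply]
  simp [xi₁, tail_single_zero, fderiv_eq_sum_pd, Fin.tail]

theorem metricFH_xi₂ (f h : (Fin p → ℝ) → ℝ) (q : Coord p) : metricFH f h q (xi₂ h q) = 0 := by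
  refine LinearMap.ext fun v => ?_
  rw [metricFH_apply]
  simp [xi₂, fderiv_eq_sum_pd, Fin.tail]

/-- The frame `ξ_1, ξ_2` of the radical distribution. -/
noncomputable def radicalFrame (f h : (Fin p → ℝ) → ℝ) : Fin 2 → Coord p → Coord p :=
  ![xi₁ f, xi₂ h]

/-- The vectors `w_1, w_2` of the ambient space. -/
def normalFrame (p : ℕ) : Fin 2 → Ambient p :=
  ![(0, 0, 1, 0), (0, 0, 0, 1)]

theorem tail_radicalFrame (f h : (Fin p → ℝ) → ℝ) (i : Fin 2) (q : Coord p) :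
    Fin.tail (radicalFrame f h i q).1 = 0 := by
  fin_cases i
  exacts [tail_single_zero 1, rfl]

theorem ambientMetric_fderiv_normalFrame {q : Coord p} (hf : DifferentiableAt ℝ f (Fin.tail q.1))
    (hh : DifferentiableAt ℝ h (Fin.tail q.1)) (v : Coord p) (i : Fin 2) :
    ambientMetric p (fderiv ℝ (embFH f h) q v) (normalFrame p i) =
      ![v.1 0 + fderiv ℝ f (Fin.tail q.1) (Fin.tail v.1),
        v.2 0 + fderiv ℝ h (Fin.tail q.1) (Fin.tail v.1)] i := by
  rw [fderiv_embFH hf hh]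
  fin_cases i <;> simp [ambientMetric_apply, normalFrame]

theorem isNullRigging_embFH (hO : IsOpen O) (hf : ContDiffOn ℝ ∞ f O) (hh : ContDiffOn ℝ ∞ h O) :
    IsNullRigging (ambientMetric p) (embFH f h) (domain O) (radicalFrame f h) (normalFrame p) where
  contDiffOn := Fin.forall_fin_two.mpr ⟨contDiffOn_xi₁ hO hf, contDiffOn_xi₂ hO hh⟩
  mem_ker q hq := by
    rw [inducedMetric_embFH (differentiableAt_of_mem_domain hO hf hq)
      (differentiableAt_of_mem_domain hO hh hq)]
    exact Fin.forall_fin_two.mpr ⟨metricFH_xi₁ f h q, metricFH_xi₂ f h q⟩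
  pairing q hq i j := by
    rw [ambientMetric_fderiv_normalFrame (differentiableAt_of_mem_domain hO hf hq)
      (differentiableAt_of_mem_domain hO hh hq), tail_radicalFrame]
    fin_cases i <;> fin_cases j <;> simp [radicalFrame, xi₁, xi₂]
  orthonormal i j := by
    fin_cases i <;> fin_cases j <;> simp [ambientMetric_apply, normalFrame]

theorem isAdaptedNullRigging_embFH (hO : IsOpen O) (hf : ContDiffOn ℝ ∞ f O)
    (hh : ContDiffOn ℝ ∞ h O) : IsAdaptedNullRigging (ambientMetric p) (embFH f h) (domain O)
      (radicalFrame f h) (normalFrame p) where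
  toIsNullRigging := isNullRigging_embFH hO hf hh
  fderiv_fderiv_mem_span q hq x y := by
    rw [fderiv_fderiv_embFH hO hf hh hq, Submodule.mem_span_range_iff_exists_fun]
    exact ⟨![fderiv ℝ (fderiv ℝ f) (Fin.tail q.1) (Fin.tail x.1) (Fin.tail y.1),
      fderiv ℝ (fderiv ℝ h) (Fin.tail q.1) (Fin.tail x.1) (Fin.tail y.1)], by simp [normalFrame]⟩
  fderiv_fderiv_eq_zero q hq x i := by
    simp [fderiv_fderiv_embFH hO hf hh hq, tail_radicalFrame]

theorem tail_fieldV (i : Fin p) : Fin.tail (fieldV i).1 = 0 :=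
  rfl

theorem isParallelCoisotropic_ker_tailL (hO : IsOpen O) (hf : ContDiffOn ℝ ∞ f O)
    (hh : ContDiffOn ℝ ∞ h O) : IsParallelCoisotropic (ambientMetric p) (embFH f h) (domain O)
      (LinearMap.ker (tailL p).toLinearMap) where
  orthogonal_le q hq v hv := by
    ext i
    have hvi := hv (fieldV i) rfl
    rw [inducedMetric_embFH (differentiableAt_of_mem_domain hO hf hq)
      (differentiableAt_of_mem_domain hO hh hq), metricFH_apply, tail_fieldV, map_zero,
      map_zero] at hvi
    simpa [fieldV, Pi.single_apply, tailL_apply, Fin.tail] using hvi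
  eventually_fderiv_eq q hq k hk := by
    have hconst (q' : Coord p) (hq' : q' ∈ domain O) :
        fderiv ℝ (embFH f h) q' k = (k.1, k.2, 0, 0) := by
      have hk0 : Fin.tail k.1 = 0 := hk
      rw [fderiv_embFH (differentiableAt_of_mem_domain hO hf hq')
        (differentiableAt_of_mem_domain hO hh hq'), hk0, map_zero, map_zero]
    filter_upwards [(isOpen_domain hO).eventually_mem hq] with q' hq'
    rw [hconst q' hq', hconst q hq]

theorem finrank_coord (p : ℕ) : Module.finrank ℝ (Coord p) = 2 * p + 2 := by
  simp only [Module.finrank_prod, Module.finrank_fin_fun]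
  ring

theorem finrank_ambient_eq_finrank_coord_add_two (p : ℕ) :
    Module.finrank ℝ (Ambient p) = Module.finrank ℝ (Coord p) + 2 := by
  rw [finrank_ambient, finrank_coord]

theorem isCoisotropic_embFH (hO : IsOpen O) (hf : ContDiffOn ℝ ∞ f O) (hh : ContDiffOn ℝ ∞ h O) :
    IsCoisotropic (ambientMetric p) (embFH f h) (domain O) 2 :=
  (isNullRigging_embFH hO hf hh).isCoisotropic isSymm_ambientMetric nondegenerate_ambientMetric
    (isSmoothEmbedding_embFH hO hf hh) two_pos (finrank_ambient_eq_finrank_coord_add_two p)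

theorem radSpace_embFH (hO : IsOpen O) (hf : ContDiffOn ℝ ∞ f O) (hh : ContDiffOn ℝ ∞ h O)
    {q : Coord p} (hq : q ∈ domain O) :
    radSpace (ambientMetric p) (embFH f h) q =
      Submodule.span ℝ {fderiv ℝ (embFH f h) q (xi₁ f q), fderiv ℝ (embFH f h) q (xi₂ h q)} := by
  rw [← (isNullRigging_embFH hO hf hh).span_eq_radSpace isSymm_ambientMetric
    nondegenerate_ambientMetric hq ((isSmoothEmbedding_embFH hO hf hh).immersion q hq)
    (finrank_ambient_eq_finrank_coord_add_two p), ← Matrix.range_cons_cons_empty _ _ ![]]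
  congr 2
  ext i : 1
  fin_cases i <;> rfl

theorem finrank_ker_metricFH (hO : IsOpen O) (hf : ContDiffOn ℝ ∞ f O) (hh : ContDiffOn ℝ ∞ h O)
    {q : Coord p} (hq : q ∈ domain O) :
    Module.finrank ℝ (LinearMap.ker (metricFH f h q)) = 2 := by
  rw [← inducedMetric_embFH (differentiableAt_of_mem_domain hO hf hq)
    (differentiableAt_of_mem_domain hO hh hq), ← finrank_radSpace isSymm_ambientMetric
    ((isSmoothEmbedding_embFH hO hf hh).immersion q hq)]
  exact (isCoisotropic_embFH hO hf hh).isLightlike.rank q hq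

end Rigging

section CanonicalScreens

variable {p : ℕ} {O : Set (Fin p → ℝ)} {f h : (Fin p → ℝ) → ℝ}

/-- The frame `U_1, …, U_p, V_1, …, V_p` of the screen distribution. -/
noncomputable def screenFrame (f h : (Fin p → ℝ) → ℝ) : Fin p ⊕ Fin p → Coord p → Coord p :=
  Sum.elim (fieldU f h) fun i _ => fieldV i

theorem contDiffOn_screenFrame (hO : IsOpen O) (hf : ContDiffOn ℝ ∞ f O) (hh : ContDiffOn ℝ ∞ h O) :
    ∀ i, ContDiffOn ℝ ∞ (screenFrame f h i) (domain O)
  | .inl i => (contDiffOn_const.sub ((contDiffOn_comp_tail (contDiffOn_pd hO hf i)).smul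
      contDiffOn_const)).prodMk
        ((contDiffOn_comp_tail (contDiffOn_pd hO hh i)).smul contDiffOn_const).neg
  | .inr _ => contDiffOn_const

theorem tail_fieldU (f h : (Fin p → ℝ) → ℝ) (i : Fin p) (q : Coord p) :
    Fin.tail (fieldU f h i q).1 = Pi.single i 1 := by
  ext j
  simp [fieldU, Fin.tail, Pi.single_apply]

theorem linearIndependent_screenFrame (f h : (Fin p → ℝ) → ℝ) (q : Coord p) :
    LinearIndependent ℝ fun i => screenFrame f h i q := by
  let tails : Coord p →ₗ[ℝ] (Fin p → ℝ) × (Fin p → ℝ) :=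
    (LinearMap.funLeft ℝ ℝ Fin.succ).prodMap (LinearMap.funLeft ℝ ℝ Fin.succ)
  refine .of_comp tails ?_
  convert ((Pi.basisFun ℝ (Fin p)).prod (Pi.basisFun ℝ (Fin p))).linearIndependent using 1
  ext (i | i) j <;>
    simp [tails, screenFrame, fieldU, fieldV, Pi.single_apply, LinearMap.funLeft_apply]

theorem ambientMetric_fderiv_screenFrame_normalFrame {q : Coord p}
    (hf : DifferentiableAt ℝ f (Fin.tail q.1)) (hh : DifferentiableAt ℝ h (Fin.tail q.1))
    (i : Fin p ⊕ Fin p) (j : Fin 2) :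
    ambientMetric p (fderiv ℝ (embFH f h) q (screenFrame f h i q)) (normalFrame p j) = 0 := by
  rw [ambientMetric_fderiv_normalFrame hf hh]
  rcases i with i | i
  · rw [screenFrame, Sum.elim_inl, tail_fieldU]
    fin_cases j <;> simp [fieldU, pd]
  · rw [screenFrame, Sum.elim_inr, tail_fieldV, map_zero, map_zero]
    fin_cases j <;> simp [fieldV]

theorem screensFH_screen (f h : (Fin p → ℝ) → ℝ) (q : Coord p) :
    (screensFH f h).screen q =
      Submodule.span ℝ (Set.range fun i => fderiv ℝ (embFH f h) q (screenFrame f h i q)) := by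
  change Submodule.span ℝ (_ ∪ _) = _
  rw [← Set.Sum.elim_range]
  congr 2
  ext (i | i) : 1 <;> rfl

theorem screensFH_ltr (f h : (Fin p → ℝ) → ℝ) (q : Coord p) :
    (screensFH f h).ltr q = Submodule.span ℝ (Set.range fun i =>
      lightlikeTransversal (embFH f h) (radicalFrame f h) (normalFrame p) i q) := by
  change Submodule.span ℝ {_, _} = _
  rw [← Matrix.range_cons_cons_empty _ _ ![]]
  congr 2
  ext i : 1
  fin_cases i <;> rfl

theorem isAdmissible_screensFH (hO : IsOpen O) (hf : ContDiffOn ℝ ∞ f O) (hh : ContDiffOn ℝ ∞ h O) :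
    IsAdmissible (ambientMetric p) (embFH f h) (domain O) 2 (screensFH f h) := by
  have hF := isSmoothEmbedding_embFH hO hf hh
  have hcodim := finrank_ambient_eq_finrank_coord_add_two p
  have hrigging := isAdaptedNullRigging_embFH hO hf hh
  refine hrigging.isAdmissible isSymm_ambientMetric hF hcodim (fun q _ => ?_) ?_
  · rw [Screens.tr, screensFH_ltr]
    exact sup_bot_eq _
  · exact hrigging.isScreens isSymm_ambientMetric nondegenerate_ambientMetric hF hcodim
      (contDiffOn_screenFrame hO hf hh) (fun q _ => linearIndependent_screenFrame f h q)
      (by rw [finrank_coord, Fintype.card_sum, Fintype.card_fin, two_mul])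
      (fun q hq => ambientMetric_fderiv_screenFrame_normalFrame
        (differentiableAt_of_mem_domain hO hf hq) (differentiableAt_of_mem_domain hO hh hq))
      (fun q _ => screensFH_screen f h q) (fun _ _ => rfl) fun q _ => screensFH_ltr f h q

end CanonicalScreens

end LightlikeOsserman

open LightlikeOsserman in
theorem mainTheorem12_general (p : ℕ) (O : Set (Fin p → ℝ)) (hO : IsOpen O)
    (f h : (Fin p → ℝ) → ℝ) (hf : ContDiffOn ℝ ∞ f O) (hh : ContDiffOn ℝ ∞ h O) :
    IsSemiEuclidean (ambientMetric p) (p + 2) (p + 2) ∧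
    IsSmoothEmbedding (domain O) (embFH f h) ∧
    (∀ q ∈ domain O, inducedMetric (ambientMetric p) (embFH f h) q = metricFH f h q) ∧
    (∀ q ∈ domain O, Module.finrank ℝ (LinearMap.ker (metricFH f h q)) = 2) ∧
    IsCoisotropic (ambientMetric p) (embFH f h) (domain O) 2 ∧
    (∀ q ∈ domain O, radSpace (ambientMetric p) (embFH f h) q =
      Submodule.span ℝ {fderiv ℝ (embFH f h) q (xi₁ f q), fderiv ℝ (embFH f h) q (xi₂ h q)}) ∧
    IsAdmissible (ambientMetric p) (embFH f h) (domain O) 2 (screensFH f h) ∧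
    (∀ 𝒮 : Screens (Coord p) (Ambient p),
      IsAdmissible (ambientMetric p) (embFH f h) (domain O) 2 𝒮 →
      ∀ q ∈ domain O, ∀ x : Coord p, ∀ R, IsInducedCurvature (ambientMetric p) (embFH f h) 𝒮 q R →
      ∀ ξ N : Fin 2 → Ambient p, IsDualFrame (ambientMetric p) (embFH f h) 𝒮 q ξ N →
        (∃! J, IsPseudoJacobi (associatedMetric (ambientMetric p) (embFH f h) q N) R x J) ∧
        ∀ J, IsPseudoJacobi (associatedMetric (ambientMetric p) (embFH f h) q N) R x J →
          IsNilpotent J ∧ J.charpoly = Polynomial.X ^ (2 * p + 2)) ∧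
    IsGloballyOsserman (ambientMetric p) (embFH f h) (domain O) 2 :=
  ⟨isSemiEuclidean_ambientMetric p, isSmoothEmbedding_embFH hO hf hh,
    fun _ hq => inducedMetric_embFH (differentiableAt_of_mem_domain hO hf hq)
      (differentiableAt_of_mem_domain hO hh hq),
    fun _ hq => finrank_ker_metricFH hO hf hh hq, isCoisotropic_embFH hO hf hh,
    fun _ hq => radSpace_embFH hO hf hh hq, isAdmissible_screensFH hO hf hh,
    fun _ h𝒮 _ hq x _ hR _ _ hN => finrank_coord p ▸
      (isParallelCoisotropic_ker_tailL hO hf hh).existsUnique_pseudoJacobi_and_charpoly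
        isSymm_ambientMetric (isSmoothEmbedding_embFH hO hf hh) h𝒮 hq x hR hN,
    (isParallelCoisotropic_ker_tailL hO hf hh).isGloballyOsserman isSymm_ambientMetric
      (isSmoothEmbedding_embFH hO hf hh) 2⟩

open LightlikeOsserman in
theorem mainTheorem12 (p : ℕ) (O : Set (Fin p → ℝ)) (hO : IsOpen O)
    (f h : (Fin p → ℝ) → ℝ) (hf : ContDiffOn ℝ ∞ f O) (hh : ContDiffOn ℝ ∞ h O) :
    -- the ambient metric has signature `(p + 2, p + 2)`
    IsSemiEuclidean (ambientMetric p) (p + 2) (p + 2) ∧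
    -- `g_(f,h)` is the metric induced by the embedding `F`, and it is 2-degenerate
    IsSmoothEmbedding (domain O) (embFH f h) ∧
    (∀ q ∈ domain O, inducedMetric (ambientMetric p) (embFH f h) q = metricFH f h q) ∧
    (∀ q ∈ domain O, Module.finrank ℝ (LinearMap.ker (metricFH f h q)) = 2) ∧
    -- the submanifold is coisotropic, with radical distribution spanned by `ξ_1`, `ξ_2`
    IsCoisotropic (ambientMetric p) (embFH f h) (domain O) 2 ∧
    (∀ q ∈ domain O, radSpace (ambientMetric p) (embFH f h) q =
      Submodule.span ℝ {fderiv ℝ (embFH f h) q (xi₁ f q), fderiv ℝ (embFH f h) q (xi₂ h q)}) ∧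
    -- the screen distribution spanned by the `U_i`, `V_i` is admissible
    IsAdmissible (ambientMetric p) (embFH f h) (domain O) 2 (screensFH f h) ∧
    -- for all admissible screens, the pseudo-Jacobi operators are well defined, nilpotent, and have
    -- characteristic polynomial `λ ^ (2 p + 2)`
    (∀ 𝒮 : Screens (Coord p) (Ambient p),
      IsAdmissible (ambientMetric p) (embFH f h) (domain O) 2 𝒮 →
      ∀ q ∈ domain O, ∀ x : Coord p, metricFH f h q x x = 1 ∨ metricFH f h q x x = -1 →
      ∀ R, IsInducedCurvature (ambientMetric p) (embFH f h) 𝒮 q R →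
      ∀ ξ N : Fin 2 → Ambient p, IsDualFrame (ambientMetric p) (embFH f h) 𝒮 q ξ N →
        (∃! J, IsPseudoJacobi (associatedMetric (ambientMetric p) (embFH f h) q N) R x J) ∧
        ∀ J, IsPseudoJacobi (associatedMetric (ambientMetric p) (embFH f h) q N) R x J →
          IsNilpotent J ∧ J.charpoly = Polynomial.X ^ (2 * p + 2)) ∧
    IsGloballyOsserman (ambientMetric p) (embFH f h) (domain O) 2 := by
  obtain ⟨hsig, hemb, hg, hker, hco, hrad, hadm, hJ, hoss⟩ :=
    mainTheorem12_general p O hO f h hf hh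
  exact ⟨hsig, hemb, hg, hker, hco, hrad, hadm, fun 𝒮 h𝒮 q hq x _ => hJ 𝒮 h𝒮 q hq x, hoss⟩
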